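/- Let $K\ge 2$ and $d\ge 1$ be integers, let $\mathcal G\in\{\mathcal O(d),\mathcal{SO}(d)\}$, and let $0<a\le b$. For $n=Km$, fix a balanced clustering function $C^*:[n]\to[K]$ (every cluster has exactly $m$ elements) and $R^*_1,\dots,R^*_n\in\mathcal G$. The ground truth $V^*\in\mathbb R^{nd\times Kd}$ is the block matrix whose $(i,k)$ block ($d\times d$) is $R_i^*$ if $C^*(i)=k$ and $0$ otherwise. Let $\mathcal F$ be the set of all matrices of this form built from any balanced clustering and any elements of $\mathcal O(d)$. The stochastic group block model $\mathrm{SGBM}(n,p,q,K,d,\mathcal G)$ generates a symmetric random $A\in\mathbb R^{nd\times nd}$ with $A_{ii}=I_d$ and, independently over the pairs $i<j$: if $C^*(i)=C^*(j)$ then $A_{ij}=R_i^*R_j^{*\top}$ with probability $p$ and $A_{ij}=0$ otherwise; if $C^*(i)\ne C^*(j)$ then with probability $q$ the block $A_{ij}$ is uniformly (Haar) distributed on $\mathcal G$, and $A_{ij}=0$ otherwise; finally $A_{ji}=A_{ij}^\top$. For $X\in\mathbb R^{nd\times Kd}$ let $\mu(X)\in\mathbb R^{n\times K}$ be the matrix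 of the nuclear norms of its $d\times d$ blocks, and let $$\epsilon_{\mathcal O(d)}(V)=\min_{Q}\|V-V^*Q\|_F,$$ where $Q$ ranges over all matrices $\mathrm{bdiag}(U_1,\dots,U_K)(P\otimes I_d)$ with $U_k\in\mathcal O(d)$ and $P$ a $K\times K$ permutation matrix. A sequence of iterates of the generalized power method (GPM) with input $A$ is any sequence $V^0,V^1,\dots$ with $V^0\in\mathcal F$ and $V^{t+1}\in\operatorname{argmin}_{W\in\mathcal F}\|W-AV^t\|_F$ for all $t\ge 0$. **Theorem.** There is $c>0$, depending only on $K,d,\mathcal G,a,b$, such that for every $\chi_0>0$ there is $N$ with the following property. Let $n=Km\ge N$, let $C^*$, $R^*$ be as above, let $\alpha,\beta\in[a,b]$, $p=\frac{\alpha\log n}{n}$, $q=\frac{\beta\log n}{n}$, and let $A$ be generated by $\mathrm{SGBM}(n,p,q,K,d,\mathcal G)$. Then with probability at least $1-n^{-c}$ the following holds simultaneously for all $\chi\ge\chi_0$ and all sequences $V^0,V^1,\dots$ of GPM iterates with input $A$: if (i) $\chi mp>0$ and $\mu(AV^*)_{iC^*(i)}-\mu(AV^*)_{ij}\ge\chi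 mp$ for all $i\in[n]$ and all $j\ne C^*(i)$; (ii) $\mu(AV^*)_{iC^*(i)}\ge\frac{\sqrt{2K\beta}}{\alpha}\,mp$ for all $i\in[n]$; (iii) $\epsilon_{\mathcal O(d)}(V^0)\le\frac{\sqrt m}{\rho}$ for some $\rho>2\sqrt2\sqrt{\frac{d^2}{\chi^2}+\frac{\alpha^2}{2K\beta}}$; then $\epsilon_{\mathcal O(d)}(V^{t+1})\le\frac12\,\epsilon_{\mathcal O(d)}(V^t)$ for every $t\ge 0$. -/

import Mathlib

namespace GPM

open MeasureTheory

/-- The two groups that are synchronized: the orthogonal and the special orthogonal group. -/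
inductive GroupKind : Type
  | orthogonal : GroupKind
  | specialOrthogonal : GroupKind

/-- The orthogonal group `O(d)` (unitary matrices over `ℝ`, where the star is trivial). -/
abbrev OGroup (d : ℕ) : Submonoid (Matrix (Fin d) (Fin d) ℝ) :=
  Matrix.unitaryGroup (Fin d) ℝ

theorem mem_OGroup_iff {d : ℕ} (Q : Matrix (Fin d) (Fin d) ℝ) :
    Q ∈ OGroup d ↔ Q * Q.transpose = 1 ∧ Q.transpose * Q = 1 := by
  have h : star Q = Q.transpose := by
    rw [Matrix.star_eq_conjTranspose, Matrix.conjTranspose_eq_transpose_of_trivial]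
  constructor
  · intro hQ
    refine ⟨?_, ?_⟩
    · rw [← h]; exact Matrix.mem_unitaryGroup_iff.1 hQ
    · rw [← h]; exact Matrix.mem_unitaryGroup_iff'.1 hQ
  · intro hQ
    rw [Matrix.mem_unitaryGroup_iff, h]
    exact hQ.1

/-- The determinant as a homomorphism on `O(d)`. -/
def detHom (d : ℕ) : OGroup d →* ℝ :=
  Matrix.detMonoidHom.comp (OGroup d).subtype

/-- The group `𝒢 ∈ {O(d), SO(d)}`, as a subgroup of `O(d)`; `SO(d)` is the kernel of `det`. -/
def groupOf (d : ℕ) : GroupKind → Subgroup (OGroup d)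
  | GroupKind.orthogonal => ⊤
  | GroupKind.specialOrthogonal => (detHom d).ker

/-- The `d × d` matrix of a group element. -/
def toMat {d : ℕ} {κ : GroupKind} (g : groupOf d κ) : Matrix (Fin d) (Fin d) ℝ :=
  ((g : OGroup d) : Matrix (Fin d) (Fin d) ℝ)

theorem continuous_toMat {d : ℕ} {κ : GroupKind} :
    Continuous (toMat : groupOf d κ → Matrix (Fin d) (Fin d) ℝ) :=
  continuous_subtype_val.comp continuous_subtype_val

instance (d : ℕ) : CompactSpace (OGroup d) := by
  have hcl : IsClosed ((OGroup d : Set (Matrix (Fin d) (Fin d) ℝ))) := isClosed_unitary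
  have hbox : IsCompact (Set.univ.pi fun _ : Fin d => Set.univ.pi fun _ : Fin d =>
      Set.Icc (-1 : ℝ) 1) :=
    isCompact_univ_pi fun _ => isCompact_univ_pi fun _ => isCompact_Icc
  refine isCompact_iff_compactSpace.1 (hbox.of_isClosed_subset hcl ?_)
  intro U hU
  simp only [Set.mem_pi, Set.mem_univ, true_implies]
  intro i j
  have h := entry_norm_bound_of_unitary (𝕜 := ℝ) hU i j
  exact abs_le.1 h

instance (d : ℕ) (κ : GroupKind) : CompactSpace (groupOf d κ) := by
  refine isCompact_iff_compactSpace.1 (IsClosed.isCompact ?_)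
  cases κ with
  | orthogonal => exact isClosed_univ
  | specialOrthogonal =>
    have hc : Continuous (detHom d) := Continuous.matrix_det continuous_subtype_val
    exact isClosed_singleton.preimage hc

instance (d : ℕ) (κ : GroupKind) : MeasurableSpace (groupOf d κ) := borel _

instance (d : ℕ) (κ : GroupKind) : BorelSpace (groupOf d κ) := ⟨rfl⟩

/-- The uniform distribution on `𝒢`: the Haar measure of total mass one. -/
noncomputable def unif (d : ℕ) (κ : GroupKind) : Measure (groupOf d κ) :=
  Measure.haarMeasure ⊤

/-- A balanced clustering function: each of the `K` clusters has exactly `m` members. -/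
def Balanced {n K : ℕ} (m : ℕ) (C : Fin n → Fin K) : Prop :=
  ∀ k, (Finset.univ.filter fun i => C i = k).card = m

/-- The probability space behind the stochastic group block model: independently for each pair,
a Bernoulli edge indicator, with parameter `p` inside a cluster and `q` across clusters, and an
independent uniform element of `𝒢`. Only the pairs `i < j` are used.
(Numbers outside `[0,1]` are clamped; for `0 ≤ p, q ≤ 1` nothing is changed.) -/
noncomputable def sgbmMeasure {n K : ℕ} (d : ℕ) (κ : GroupKind) (p q : ℝ) (C : Fin n → Fin K) :
    Measure (Fin n × Fin n → Bool × groupOf d κ) :=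
  Measure.pi fun e =>
    (ProbabilityTheory.bernoulliMeasure true false
      (Set.projIcc (0 : ℝ) 1 zero_le_one (if C e.1 = C e.2 then p else q))).prod (unif d κ)

/-- The block of the observation above the diagonal (`i < j`). -/
noncomputable def upperBlock {n K d : ℕ} {κ : GroupKind} (C : Fin n → Fin K)
    (R : Fin n → groupOf d κ) (ω : Fin n × Fin n → Bool × groupOf d κ) (i j : Fin n) :
    Matrix (Fin d) (Fin d) ℝ :=
  if (ω (i, j)).1 = true then
    if C i = C j then toMat (R i) * (toMat (R j)).transpose else toMat (ω (i, j)).2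
  else 0

/-- The observation matrix `A ∈ ℝ^{nd × nd}` generated by the stochastic group block model with
clustering function `C` and group elements `R`, as a function of the random outcome `ω`. -/
noncomputable def observation {n K d : ℕ} {κ : GroupKind} (C : Fin n → Fin K)
    (R : Fin n → groupOf d κ) (ω : Fin n × Fin n → Bool × groupOf d κ) :
    Matrix (Fin n × Fin d) (Fin n × Fin d) ℝ :=
  Matrix.of fun x y =>
    (if x.1 = y.1 then (1 : Matrix (Fin d) (Fin d) ℝ)
      else if x.1 < y.1 then upperBlock C R ω x.1 y.1
      else (upperBlock C R ω y.1 x.1).transpose) x.2 y.2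

/-- The matrix in `ℝ^{nd × Kd}` whose `(i, k)` block is `R i` if `C i = k` and `0` otherwise. -/
noncomputable def assemble {n K d : ℕ} {κ : GroupKind} (C : Fin n → Fin K)
    (R : Fin n → groupOf d κ) : Matrix (Fin n × Fin d) (Fin K × Fin d) ℝ :=
  Matrix.of fun x y => if C x.1 = y.1 then toMat (R x.1) x.2 y.2 else 0

/-- The feasible region of `𝒢`: all matrices built from a balanced clustering and elements of
`𝒢`. -/
def feasible (n K d m : ℕ) (κ : GroupKind) : Set (Matrix (Fin n × Fin d) (Fin K × Fin d) ℝ) :=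
  {V | ∃ (C : Fin n → Fin K) (R : Fin n → groupOf d κ), Balanced m C ∧ V = assemble C R}

/-- The relaxed feasible region `𝓕`, with group elements in `O(d)`. -/
abbrev relaxed (n K d m : ℕ) : Set (Matrix (Fin n × Fin d) (Fin K × Fin d) ℝ) :=
  feasible n K d m GroupKind.orthogonal

section Norms

open scoped Matrix.Norms.Frobenius

/-- The Frobenius norm. -/
noncomputable def frobNorm {ι ι' : Type*} [Fintype ι] [Fintype ι'] (X : Matrix ι ι' ℝ) : ℝ := ‖X‖

end Norms

/-- The nuclear norm of a `d × d` matrix: the sum of its singular values. -/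
noncomputable def nuclearNorm {d : ℕ} (X : Matrix (Fin d) (Fin d) ℝ) : ℝ :=
  ∑ k ∈ Finset.range d, (Matrix.toEuclideanLin X).singularValues k

/-- The `(i, k)` block of size `d × d`. -/
def block {n K d : ℕ} (X : Matrix (Fin n × Fin d) (Fin K × Fin d) ℝ) (i : Fin n) (k : Fin K) :
    Matrix (Fin d) (Fin d) ℝ :=
  Matrix.of fun a b => X (i, a) (k, b)

/-- The blockwise nuclear norm `μ(X) ∈ ℝ^{n × K}`. -/
noncomputable def blockNuclear {n K d : ℕ} (X : Matrix (Fin n × Fin d) (Fin K × Fin d) ℝ) :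
    Matrix (Fin n) (Fin K) ℝ :=
  Matrix.of fun i k => nuclearNorm (block X i k)

/-- `W` is a projection of `X` onto `𝓕`, i.e. a minimizer of the Frobenius distance to `X`. -/
def IsProj {n K d : ℕ} (m : ℕ) (X W : Matrix (Fin n × Fin d) (Fin K × Fin d) ℝ) : Prop :=
  W ∈ relaxed n K d m ∧ ∀ W' ∈ relaxed n K d m, frobNorm (W - X) ≤ frobNorm (W' - X)

/-- `V 0, V 1, …` is a sequence generated by the generalized power method on input `A`, `V 0`. -/
def IsGPMSequence {n K d : ℕ} (m : ℕ) (A : Matrix (Fin n × Fin d) (Fin n × Fin d) ℝ)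
    (V : ℕ → Matrix (Fin n × Fin d) (Fin K × Fin d) ℝ) : Prop :=
  V 0 ∈ relaxed n K d m ∧ ∀ t, IsProj m (A * V t) (V (t + 1))

/-- The block diagonal matrix with the given `d × d` diagonal blocks. -/
noncomputable def bdiag {K d : ℕ} {κ : GroupKind} (U : Fin K → groupOf d κ) :
    Matrix (Fin K × Fin d) (Fin K × Fin d) ℝ :=
  Matrix.of fun x y => if x.1 = y.1 then toMat (U x.1) x.2 y.2 else 0

/-- The set of all `bdiag(U) (P ⊗ I_d)`, with `U ∈ 𝒢^K` and `P` a `K × K` permutation matrix. -/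
def symGroup (K d : ℕ) (κ : GroupKind) : Set (Matrix (Fin K × Fin d) (Fin K × Fin d) ℝ) :=
  {Q | ∃ (U : Fin K → groupOf d κ) (σ : Equiv.Perm (Fin K)),
    Q = bdiag U * Matrix.kroneckerMap (fun x y => x * y) (σ.permMatrix ℝ)
      (1 : Matrix (Fin d) (Fin d) ℝ)}

/-- The estimation error `ε_𝒢(V) = min ‖V - V⋆ Q‖_F`, the minimum over all `Q` in the compact
nonempty set of symmetries. -/
noncomputable def estError {n K d : ℕ} (κ : GroupKind)
    (Vstar V : Matrix (Fin n × Fin d) (Fin K × Fin d) ℝ) : ℝ :=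
  ⨅ Q : symGroup K d κ, frobNorm (V - Vstar * (Q : Matrix (Fin K × Fin d) (Fin K × Fin d) ℝ))

/-- `A` preserves `V` (with clustering function `C`) by `δ`-separation. -/
def PreservesBySeparation {n K d : ℕ} (A : Matrix (Fin n × Fin d) (Fin n × Fin d) ℝ)
    (C : Fin n → Fin K) (V : Matrix (Fin n × Fin d) (Fin K × Fin d) ℝ) (δ : ℝ) : Prop :=
  0 < δ ∧ ∀ i j, j ≠ C i → δ ≤ blockNuclear (A * V) i (C i) - blockNuclear (A * V) i j

end GPM

namespace GPM
open Matrix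

/-! ### Power moments of positive semidefinite matrices under rank-one updates -/

section PowerMoments

/-! All randomness enters through one event: `A - M` has operator norm at most a small multiple of
`mp`, where `M` is the mean of `A` up to its diagonal blocks. On this event the contraction is
deterministic, which is why it holds for all `χ` and all GPM sequences at once.

Contraction. Let `V'` be the symmetric copy `V⋆Q` nearest to the iterate `V`, put `D = V - V'`, and
let `W` be the next iterate. Then `AV = (AV' + MD) + (A - M)D`. All feasible matrices have the same
Frobenius norm, so `W` maximizes the inner product with `AV`, and `⟨V' - W, AV⟩ ≤ 0`. The separation
hypothesis, which symmetries preserve, says that each row of `AV'` favours the corresponding row of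
`V'` by a margin governed by `s = χmp`. The term `MD` does not spoil this margin because its effect
is quadratic in `D`, and `‖D‖²` is at most of order `mχ²/d²`. Hence `(s/4d)‖V' - W‖² ≤ ⟨V' - W, AV'
+ MD⟩ ≤ τ‖V' - W‖‖D‖`, and `8dτ ≤ s` yields the factor 1/2 (`norm_sub_le_of_separation`,
`estError_step`).

Why `MD` is quadratic. Against a foreign cluster this is a count of row distances
(`frobInner_diff_rows`). Against another rotation in the own cluster, optimality of `Q` makes the
cross-covariances of the clusters symmetric (`symm_of_trace_max`, `crossCov_symm`), and pairing a
symmetric matrix with `1 - Z`, `Z` orthogonal, is quadratic in `1 - Z` (`frobInner_diff_rotation`).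
Both arguments need the cross-cluster mean to vanish, which fails only for the trivial group
`SO(1)`. There the entries of `D` are integers, so `|x| ≤ x²`, and the separation itself forces `q ≤
2p` (`cross_prob_le`).

Noise. For a matrix `T` with independent centred bounded entries, `tr (TTᵀ)^(K+1)` is a sum over
columns `b` of `bᵀ(N + bbᵀ)^K b`, where `N` is the Gram matrix of the other columns and is
independent of `b`. The bound `rankOne_moment_le` separates `N` from `b`, giving a recursion in `K`
for the expected trace (`trace_moment_succ_le`). With about `log n` powers, Markov's inequality
gives norm at most `η log n` for any fixed `η > 0` (`exists_noise_bound`), and `mp` is of order `log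
n`. -/

theorem logConvex_interpolate (u : ℕ → ℝ) (h0 : ∀ i, 0 ≤ u i)
    (hlc : ∀ i, u (i + 1) ^ 2 ≤ u i * u (i + 2)) (K : ℕ) :
    ∃ x : ℝ, 0 ≤ x ∧ (∀ i ≤ K, u i ≤ u 0 * x ^ i) ∧ u 0 * x ^ K = u K := by
  -- Monotonicity of `(u i / u 0)^(1/i)`, written without roots or quotients.
  have hstep : ∀ i, u i ^ (i + 1) ≤ u 0 * u (i + 1) ^ i := by
    intro i
    induction i with
    | zero => simp
    | succ i ih =>
      rcases eq_or_lt_of_le (h0 (i + 1)) with h | h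
      · rw [← h]
        simp only [ne_eq, Nat.add_eq_zero_iff, one_ne_zero, and_false, not_false_eq_true, zero_pow]
        exact mul_nonneg (h0 0) (pow_nonneg (h0 _) _)
      · have h1 : (u (i + 1) ^ 2) ^ (i + 1) ≤ (u i * u (i + 2)) ^ (i + 1) :=
          pow_le_pow_left₀ (sq_nonneg _) (hlc i) _
        have h2 : (u i * u (i + 2)) ^ (i + 1) ≤ (u 0 * u (i + 1) ^ i) * u (i + 2) ^ (i + 1) := by
          rw [mul_pow]
          exact mul_le_mul_of_nonneg_right ih (pow_nonneg (h0 _) _)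
        have h3 : u (i + 1) ^ i * u (i + 1) ^ (i + 2)
            ≤ u (i + 1) ^ i * (u 0 * u (i + 2) ^ (i + 1)) := by
          calc u (i + 1) ^ i * u (i + 1) ^ (i + 2) = (u (i + 1) ^ 2) ^ (i + 1) := by ring
            _ ≤ _ := h1.trans h2
            _ = _ := by ring
        exact le_of_mul_le_mul_left h3 (pow_pos h i)
  rcases eq_or_lt_of_le (h0 0) with hz | hpos
  · have hzero : ∀ i, u i = 0 := by
      intro i
      have := hstep i
      rw [← hz, zero_mul] at this
      exact pow_eq_zero_iff (Nat.succ_ne_zero i) |>.1 (le_antisymm this (pow_nonneg (h0 i) _))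
    exact ⟨0, le_rfl, fun i _ => by simp [hzero], by simp [hzero]⟩
  rcases Nat.eq_zero_or_pos K with rfl | hK
  · exact ⟨0, le_rfl, fun i hi => by simp [Nat.le_zero.1 hi], by simp⟩
  -- The rate of the geometric sequence that agrees with `u` at 0 and at `K`. The bound in between
  -- follows by descending from `K` with `hstep`.
  set x : ℝ := (u K / u 0) ^ ((K : ℝ)⁻¹) with hx
  have hq : 0 ≤ u K / u 0 := div_nonneg (h0 K) hpos.le
  have hx0 : 0 ≤ x := Real.rpow_nonneg hq _
  have hxK : u 0 * x ^ K = u K := by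
    rw [hx, Real.rpow_inv_natCast_pow hq hK.ne']
    field_simp
  refine ⟨x, hx0, fun i hi => ?_, hxK⟩
  induction hj : K - i generalizing i with
  | zero =>
    obtain rfl : i = K := by omega
    exact hxK.ge
  | succ j ih =>
    have h1 := ih (i + 1) (by omega) (by omega)
    have h2 := hstep i
    have h3 : u i ^ (i + 1) ≤ (u 0 * x ^ i) ^ (i + 1) := by
      refine h2.trans ?_
      calc u 0 * u (i + 1) ^ i ≤ u 0 * (u 0 * x ^ (i + 1)) ^ i :=
            mul_le_mul_of_nonneg_left (pow_le_pow_left₀ (h0 _) h1 _) hpos.le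
        _ = _ := by ring
    exact (pow_le_pow_iff_left₀ (h0 i) (by positivity) (Nat.succ_ne_zero i)).1 h3

variable {ι : Type*} [Fintype ι]

theorem psd_cauchySchwarz {M : Matrix ι ι ℝ} (hM : M.PosSemidef) (x y : ι → ℝ) :
    (x ⬝ᵥ M *ᵥ y) ^ 2 ≤ (x ⬝ᵥ M *ᵥ x) * (y ⬝ᵥ M *ᵥ y) := by
  have hsym : y ⬝ᵥ M *ᵥ x = x ⬝ᵥ M *ᵥ y := by
    have ht : Mᵀ = M := by simpa using hM.1.eq
    rw [dotProduct_mulVec, ← mulVec_transpose, ht, dotProduct_comm]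
  have hq : ∀ t : ℝ, 0 ≤ (y ⬝ᵥ M *ᵥ y) * (t * t) + (2 * (x ⬝ᵥ M *ᵥ y)) * t + (x ⬝ᵥ M *ᵥ x) := by
    intro t
    have h := hM.dotProduct_mulVec_nonneg (x + t • y)
    simp only [star_trivial, mulVec_add, mulVec_smul, dotProduct_add, add_dotProduct,
      smul_dotProduct, dotProduct_smul, smul_eq_mul, hsym] at h
    linarith
  have := discrim_le_zero hq
  unfold discrim at this
  nlinarith

theorem psd_quad_nonneg {M : Matrix ι ι ℝ} (hM : M.PosSemidef) (x : ι → ℝ) :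
    0 ≤ x ⬝ᵥ M *ᵥ x := by
  simpa using hM.dotProduct_mulVec_nonneg x

theorem psd_transpose {ι : Type*} {M : Matrix ι ι ℝ} (hM : M.PosSemidef) : Mᵀ = M := by
  simpa using hM.1.eq

theorem psd_vecMulVec (b : ι → ℝ) : (vecMulVec b b).PosSemidef := by
  simpa using posSemidef_vecMulVec_self_star b

theorem trace_vecMulVec_mul (b : ι → ℝ) (M : Matrix ι ι ℝ) :
    (vecMulVec b b * M).trace = b ⬝ᵥ M *ᵥ b := by
  rw [trace_mul_comm, mul_vecMulVec, trace_vecMulVec, dotProduct_comm]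

theorem dotProduct_self_nonneg (b : ι → ℝ) : 0 ≤ b ⬝ᵥ b :=
  Finset.sum_nonneg fun i _ => mul_self_nonneg (b i)

variable [DecidableEq ι]

/-- Cauchy–Schwarz for the form of `M ^ i`, applied to `b` and `M b`. -/
theorem psd_moments_logConvex {M : Matrix ι ι ℝ} (hM : M.PosSemidef) (b : ι → ℝ) (i : ℕ) :
    (b ⬝ᵥ (M ^ (i + 1)) *ᵥ b) ^ 2 ≤ (b ⬝ᵥ (M ^ i) *ᵥ b) * (b ⬝ᵥ (M ^ (i + 2)) *ᵥ b) := by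
  have h := psd_cauchySchwarz (hM.pow i) b (M *ᵥ b)
  have e1 : b ⬝ᵥ (M ^ i) *ᵥ (M *ᵥ b) = b ⬝ᵥ (M ^ (i + 1)) *ᵥ b := by
    rw [mulVec_mulVec, ← pow_succ]
  have e2 : (M *ᵥ b) ⬝ᵥ (M ^ i) *ᵥ (M *ᵥ b) = b ⬝ᵥ (M ^ (i + 2)) *ᵥ b := by
    rw [mulVec_mulVec, ← pow_succ, dotProduct_comm, dotProduct_mulVec, ← mulVec_transpose,
      psd_transpose hM, mulVec_mulVec, ← pow_succ', dotProduct_comm]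
  rwa [e1, e2] at h

theorem psd_moments_interpolate {M : Matrix ι ι ℝ} (hM : M.PosSemidef) (b : ι → ℝ) (K : ℕ) :
    ∃ x : ℝ, 0 ≤ x ∧ (∀ i ≤ K, b ⬝ᵥ (M ^ i) *ᵥ b ≤ (b ⬝ᵥ b) * x ^ i) ∧
      (b ⬝ᵥ b) * x ^ K = b ⬝ᵥ (M ^ K) *ᵥ b := by
  simpa using logConvex_interpolate (fun i => b ⬝ᵥ (M ^ i) *ᵥ b)
    (fun i => psd_quad_nonneg (hM.pow i) b) (psd_moments_logConvex hM b) K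

/-- The recursion for the mixed moments of a rank-one update. -/
theorem mixedMoment_succ (N : Matrix ι ι ℝ) (b : ι → ℝ) (i K : ℕ) :
    b ⬝ᵥ (N ^ i * (N + vecMulVec b b) ^ (K + 1)) *ᵥ b
      = b ⬝ᵥ (N ^ (i + 1) * (N + vecMulVec b b) ^ K) *ᵥ b
        + (b ⬝ᵥ (N ^ i) *ᵥ b) * (b ⬝ᵥ (N ^ 0 * (N + vecMulVec b b) ^ K) *ᵥ b) := by
  have : N ^ i * (N + vecMulVec b b) ^ (K + 1)
      = N ^ (i + 1) * (N + vecMulVec b b) ^ K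
        + N ^ i * (vecMulVec b b * (N + vecMulVec b b) ^ K) := by
    rw [pow_succ', pow_succ]; noncomm_ring
  rw [this, add_mulVec, dotProduct_add, pow_zero, one_mul]
  congr 1
  rw [← mulVec_mulVec, ← mulVec_mulVec, vecMulVec_mulVec]
  simp only [op_smul_eq_smul, mulVec_smul, dotProduct_smul, smul_eq_mul]
  ring

theorem mixedMoment_nonneg {N : Matrix ι ι ℝ} (hN : N.PosSemidef) (b : ι → ℝ) (i K : ℕ) :
    0 ≤ b ⬝ᵥ (N ^ i * (N + vecMulVec b b) ^ K) *ᵥ b := by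
  induction K generalizing i with
  | zero => simpa using psd_quad_nonneg (hN.pow i) b
  | succ K ih =>
    rw [mixedMoment_succ]
    exact add_nonneg (ih _) (mul_nonneg (psd_quad_nonneg (hN.pow i) b) (ih _))

/-- The recursion has nonnegative coefficients, so it may be compared with the scalar case in which
`N` acts as multiplication by `x` and `b bᵀ` as multiplication by `b ⬝ᵥ b`. -/
theorem mixedMoment_le {N : Matrix ι ι ℝ} (hN : N.PosSemidef) (b : ι → ℝ) {x : ℝ} (hx : 0 ≤ x)
    {K : ℕ} (h : ∀ i ≤ K, b ⬝ᵥ (N ^ i) *ᵥ b ≤ (b ⬝ᵥ b) * x ^ i) (i J : ℕ) (hiJ : i + J ≤ K) :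
    b ⬝ᵥ (N ^ i * (N + vecMulVec b b) ^ J) *ᵥ b
      ≤ (b ⬝ᵥ b) * x ^ i * (x + b ⬝ᵥ b) ^ J := by
  have hs : 0 ≤ b ⬝ᵥ b := dotProduct_self_nonneg b
  induction J generalizing i with
  | zero => simpa using h i (by omega)
  | succ J ih =>
    rw [mixedMoment_succ]
    have h1 := ih (i + 1) (by omega)
    have h2 := ih 0 (by omega)
    have h3 := h i (by omega)
    have h4 := mul_le_mul h3 h2 (mixedMoment_nonneg hN b 0 J) (by positivity)
    calc _ ≤ (b ⬝ᵥ b) * x ^ (i + 1) * (x + b ⬝ᵥ b) ^ J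
          + (b ⬝ᵥ b) * x ^ i * ((b ⬝ᵥ b) * x ^ 0 * (x + b ⬝ᵥ b) ^ J) := add_le_add h1 h4
      _ = _ := by ring

/-- The power moments of a rank-one update, in the direction of the update. -/
theorem rankOne_moment_le {N : Matrix ι ι ℝ} (hN : N.PosSemidef) (b : ι → ℝ) {θ : ℝ}
    (hθ : 0 < θ) (K : ℕ) :
    b ⬝ᵥ ((N + vecMulVec b b) ^ K) *ᵥ b
      ≤ (1 + θ) ^ K * (b ⬝ᵥ (N ^ K) *ᵥ b) + (1 + θ⁻¹) ^ K * (b ⬝ᵥ b) ^ (K + 1) := by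
  obtain ⟨x, hx, h, hK⟩ := psd_moments_interpolate hN b K
  have hs : 0 ≤ b ⬝ᵥ b := dotProduct_self_nonneg b
  have h1 := mixedMoment_le hN b hx h 0 K (by omega)
  rw [pow_zero, one_mul, pow_zero, mul_one] at h1
  refine h1.trans ?_
  rw [← hK]
  -- Whichever of `θ x` and `b ⬝ᵥ b` is larger absorbs the other, and one of the two summands of the
  -- bound suffices.
  rcases le_total (b ⬝ᵥ b) (θ * x) with hc | hc
  · have : (x + b ⬝ᵥ b) ^ K ≤ ((1 + θ) * x) ^ K :=
      pow_le_pow_left₀ (by positivity) (by linarith) _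
    rw [mul_pow] at this
    have h2 := mul_le_mul_of_nonneg_left this hs
    have h3 : 0 ≤ (1 + θ⁻¹) ^ K * (b ⬝ᵥ b) ^ (K + 1) := by positivity
    linarith
  · have hx' : x ≤ θ⁻¹ * (b ⬝ᵥ b) := by
      rw [inv_mul_eq_div, le_div_iff₀ hθ]; linarith
    have : (x + b ⬝ᵥ b) ^ K ≤ ((1 + θ⁻¹) * (b ⬝ᵥ b)) ^ K :=
      pow_le_pow_left₀ (by positivity) (by linarith) _
    rw [mul_pow] at this
    have h2 := mul_le_mul_of_nonneg_left this hs
    have h3 : 0 ≤ (1 + θ) ^ K * ((b ⬝ᵥ b) * x ^ K) := by positivity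
    rw [pow_succ]
    linarith

theorem trace_pow_mono {N : Matrix ι ι ℝ} (hN : N.PosSemidef) (b : ι → ℝ) (K : ℕ) :
    (N ^ K).trace ≤ ((N + vecMulVec b b) ^ K).trace := by
  -- The factors `N` are replaced by `N + b bᵀ` one at a time; each replacement adds a mixed moment,
  -- which is nonnegative.
  have key : ∀ J i : ℕ, (N ^ (i + J)).trace ≤ (N ^ i * (N + vecMulVec b b) ^ J).trace := by
    intro J
    induction J with
    | zero => intro i; simp
    | succ J ih =>
      intro i
      have e : N ^ i * (N + vecMulVec b b) ^ (J + 1)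
          = N ^ (i + 1) * (N + vecMulVec b b) ^ J
            + N ^ i * (vecMulVec b b * (N + vecMulVec b b) ^ J) := by
        rw [pow_succ', pow_succ]; noncomm_ring
      have e2 : (N ^ i * (vecMulVec b b * (N + vecMulVec b b) ^ J)).trace
          = b ⬝ᵥ (N ^ i * (N + vecMulVec b b) ^ J) *ᵥ b := by
        rw [trace_mul_comm, Matrix.mul_assoc, trace_vecMulVec_mul, dotProduct_mulVec,
          ← mulVec_transpose, dotProduct_comm, transpose_mul,
          psd_transpose ((hN.add (psd_vecMulVec b)).pow J), psd_transpose (hN.pow i)]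
      rw [e, trace_add, e2]
      have := ih (i + 1)
      have h0 := mixedMoment_nonneg hN b i J
      have e3 : i + (J + 1) = i + 1 + J := by ring
      rw [e3]
      linarith
  simpa using key K 0

/-- Cauchy–Schwarz on basis vectors gives `|M i j| ≤ √(M i i) √(M j j)`; the arithmetic-geometric
mean inequality does the rest. -/
theorem quad_le_trace {M : Matrix ι ι ℝ} (hM : M.PosSemidef) (y : ι → ℝ) :
    y ⬝ᵥ M *ᵥ y ≤ (y ⬝ᵥ y) * M.trace := by
  have hd : ∀ i, 0 ≤ M i i := fun i => hM.diag_nonneg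
  have hij : ∀ i j, y i * M i j * y j ≤ (y i ^ 2 * M j j + y j ^ 2 * M i i) / 2 := by
    intro i j
    have h := psd_cauchySchwarz hM (Pi.single i 1) (Pi.single j 1)
    simp only [mulVec_single_one, single_one_dotProduct, col_apply] at h
    have h2 : |M i j| ≤ √(M i i) * √(M j j) := by
      rw [← Real.sqrt_mul (hd i)]
      exact Real.abs_le_sqrt h
    have h3 : y i * M i j * y j ≤ |y i| * |y j| * (√(M i i) * √(M j j)) := by
      calc _ ≤ |y i * M i j * y j| := le_abs_self _
        _ = |y i| * |y j| * |M i j| := by rw [abs_mul, abs_mul]; ring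
        _ ≤ _ := by gcongr
    have e1 := Real.sq_sqrt (hd i)
    have e2 := Real.sq_sqrt (hd j)
    have h4 := sq_nonneg (|y i| * √(M j j) - |y j| * √(M i i))
    have h5 : (|y i| * √(M j j) - |y j| * √(M i i)) ^ 2
        = y i ^ 2 * M j j + y j ^ 2 * M i i - 2 * (|y i| * |y j| * (√(M i i) * √(M j j))) := by
      rw [sub_sq, mul_pow, mul_pow, e1, e2, sq_abs, sq_abs]; ring
    linarith
  have e : y ⬝ᵥ M *ᵥ y = ∑ i, ∑ j, y i * M i j * y j := by
    simp only [dotProduct, mulVec, Finset.mul_sum, mul_assoc]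
  rw [e]
  calc _ ≤ ∑ i, ∑ j, (y i ^ 2 * M j j + y j ^ 2 * M i i) / 2 :=
        Finset.sum_le_sum fun i _ => Finset.sum_le_sum fun j _ => hij i j
    _ = (y ⬝ᵥ y) * M.trace := by
        have a1 : ∑ i, ∑ j, y i ^ 2 * M j j = (y ⬝ᵥ y) * M.trace := by
          rw [dotProduct, trace, Finset.sum_mul_sum]; simp [sq]
        have a2 : ∑ i, ∑ j, y j ^ 2 * M i i = (y ⬝ᵥ y) * M.trace := by
          rw [Finset.sum_comm, a1]
        simp only [add_div, Finset.sum_add_distrib, ← Finset.sum_div]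
        rw [a1, a2]; ring

/-- A bound on a power trace bounds the quadratic form. -/
theorem quad_le_of_trace_pow_le {M : Matrix ι ι ℝ} (hM : M.PosSemidef) {k : ℕ} (hk : k ≠ 0)
    {L : ℝ} (hL : 0 ≤ L) (h : (M ^ k).trace ≤ L ^ k) (y : ι → ℝ) :
    y ⬝ᵥ M *ᵥ y ≤ L * (y ⬝ᵥ y) := by
  -- The rate `x` dominates the first moment and is exact for the `k`-th, so it carries the trace
  -- bound down to the first power without diagonalization.
  obtain ⟨x, hx, h1, hK⟩ := psd_moments_interpolate hM y k
  have hs : 0 ≤ y ⬝ᵥ y := dotProduct_self_nonneg y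
  have h2 := h1 1 (by omega)
  rw [pow_one, pow_one] at h2
  rcases eq_or_lt_of_le hs with hz | hpos
  · rw [← hz] at h2 ⊢; linarith
  have h3 := quad_le_trace (hM.pow k) y
  rw [← hK] at h3
  have h4 : x ^ k ≤ L ^ k := (le_of_mul_le_mul_left h3 hpos).trans h
  have h5 : x ≤ L := (pow_le_pow_iff_left₀ hx hL hk).1 h4
  nlinarith

end PowerMoments

/-! ### Gram matrices and their columns -/

section Columns

variable {ι ι' : Type*} [Fintype ι']

theorem gram_posSemidef [Fintype ι] (T : Matrix ι ι' ℝ) : (T * Tᵀ).PosSemidef := by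
  simpa using posSemidef_self_mul_conjTranspose T

theorem trace_gram_pow_succ [Fintype ι] [DecidableEq ι] (T : Matrix ι ι' ℝ) (K : ℕ) :
    ((T * Tᵀ) ^ (K + 1)).trace
      = ∑ j, (fun i => T i j) ⬝ᵥ ((T * Tᵀ) ^ K) *ᵥ (fun i => T i j) := by
  rw [pow_succ, trace_mul_comm, Matrix.mul_assoc, trace_mul_comm, Matrix.trace]
  refine Finset.sum_congr rfl fun j _ => ?_
  rw [diag_apply, Matrix.mul_assoc, mul_apply_eq_vecMul, dotProduct_mulVec]
  simp only [vecMul, mul_apply, dotProduct, transpose_apply, Finset.sum_mul, Finset.mul_sum, mul_assoc]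
  rw [Finset.sum_comm]

variable [DecidableEq ι']

/-- The Gram matrix of the columns other than `j`. -/
noncomputable def gramWithout (T : Matrix ι ι' ℝ) (j : ι') : Matrix ι ι ℝ :=
  T.updateCol j 0 * (T.updateCol j 0)ᵀ

theorem gramWithout_add (T : Matrix ι ι' ℝ) (j : ι') :
    gramWithout T j + vecMulVec (fun i => T i j) (fun i => T i j) = T * Tᵀ := by
  ext a b
  simp only [gramWithout, Matrix.add_apply, mul_apply, transpose_apply, vecMulVec_apply, updateCol_apply]
  rw [← Finset.add_sum_erase _ _ (Finset.mem_univ j),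
    ← Finset.add_sum_erase (Finset.univ) (fun x => T a x * T b x) (Finset.mem_univ j)]
  simp only [if_true, Pi.zero_apply, zero_mul, zero_add]
  rw [add_comm]
  congr 1
  refine Finset.sum_congr rfl fun x hx => ?_
  rw [if_neg (Finset.ne_of_mem_erase hx), if_neg (Finset.ne_of_mem_erase hx)]

end Columns
end GPM

namespace GPM
open Matrix MeasureTheory ProbabilityTheory

/-! ### The trace moment method for independent centred entries -/

section MomentBound

variable {Ω : Type*} [MeasurableSpace Ω] {μ : Measure Ω} [IsProbabilityMeasure μ]
variable {ι : Type*} [Fintype ι] [DecidableEq ι]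

/-- A finite family of independent centred random variables, bounded by one, with variances at
most `v`. -/
structure NoiseFamily {ι : Type*} (μ : Measure Ω) (x : ι × ι → Ω → ℝ) (v : ℝ) : Prop where
  indep : iIndepFun x μ
  measurable : ∀ e, Measurable (x e)
  abs_le_one : ∀ e ω, |x e ω| ≤ 1
  mean : ∀ e, ∫ ω, x e ω ∂μ = 0
  variance_le : ∀ e, ∫ ω, x e ω ^ 2 ∂μ ≤ v

/-- The square matrix with the given random entries. -/
def noiseMatrix {Ω ι : Type*} (x : ι × ι → Ω → ℝ) (ω : Ω) : Matrix ι ι ℝ :=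
  Matrix.of fun i j => x (i, j) ω

variable {x : ι × ι → Ω → ℝ} {v : ℝ}

omit [DecidableEq ι] in
-- The entries stay in a compact cube, on which `F` is bounded. This settles every integrability
-- question about moments and traces.
theorem NoiseFamily.integrable_continuous (h : NoiseFamily μ x v) {F : (ι × ι → ℝ) → ℝ}
    (hF : Continuous F) : Integrable (fun ω => F fun e => x e ω) μ := by
  have hc : IsCompact (Set.univ.pi fun _ : ι × ι => Set.Icc (-1 : ℝ) 1) :=
    isCompact_univ_pi fun _ => isCompact_Icc
  obtain ⟨B, hB⟩ := hc.exists_bound_of_continuousOn hF.continuousOn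
  refine Integrable.of_bound (C := B) ?_ (Filter.Eventually.of_forall fun ω => hB _ ?_)
  · exact (hF.measurable.comp (measurable_pi_lambda _ h.measurable)).aestronglyMeasurable
  · exact fun e _ => abs_le.1 (h.abs_le_one e ω)

theorem continuous_gram_pow_entry (K : ℕ) (a b : ι) (f : (ι × ι → ℝ) → Matrix ι ι ℝ)
    (hf : Continuous f) : Continuous fun y => ((f y * (f y)ᵀ) ^ K) a b :=
  ((hf.matrix_mul hf.matrix_transpose).pow K).matrix_elem a b

omit [Fintype ι] in
theorem continuous_gramWithout (j : ι) :
    Continuous fun y : ι × ι → ℝ => (Matrix.of fun i l => y (i, l)).updateCol j 0 := by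
  refine continuous_matrix fun a b => ?_
  simp only [updateCol_apply, Pi.zero_apply, of_apply]
  split_ifs <;> fun_prop

theorem NoiseFamily.integrable_gramWithout_pow (h : NoiseFamily μ x v) (j : ι) (K : ℕ) (a b : ι) :
    Integrable (fun ω => ((gramWithout (noiseMatrix x ω) j) ^ K) a b) μ :=
  h.integrable_continuous (continuous_gram_pow_entry K a b _ (continuous_gramWithout j))

theorem NoiseFamily.integrable_gram_pow_trace (h : NoiseFamily μ x v) (K : ℕ) :
    Integrable (fun ω => ((noiseMatrix x ω * (noiseMatrix x ω)ᵀ) ^ K).trace) μ := by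
  have hc : Continuous fun y : ι × ι → ℝ => (Matrix.of fun i l => y (i, l) : Matrix ι ι ℝ) :=
    continuous_matrix fun a b => by simp only [of_apply]; fun_prop
  refine h.integrable_continuous
    (F := fun y => (((Matrix.of fun i l => y (i, l)) * (Matrix.of fun i l => y (i, l))ᵀ) ^ K).trace)
    ?_
  exact continuous_finsetSum _ fun a _ => continuous_gram_pow_entry K a a _ hc

omit [IsProbabilityMeasure μ] in
/-- The column `j` is independent of the Gram matrix of the other columns. -/
theorem NoiseFamily.indep_column (h : NoiseFamily μ x v) (j : ι) (K : ℕ) (a b : ι) :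
    IndepFun (fun ω => x (a, j) ω * x (b, j) ω)
      (fun ω => ((gramWithout (noiseMatrix x ω) j) ^ K) a b) μ := by
  classical
  set S : Finset (ι × ι) := Finset.univ.filter fun e => e.2 = j
  set T : Finset (ι × ι) := Finset.univ.filter fun e => e.2 ≠ j
  have hST : Disjoint S T := Finset.disjoint_filter_filter_not _ _ _
  have hind := h.indep.indepFun_finset S T hST h.measurable
  have ha : (a, j) ∈ S := by simp [S]
  have hb : (b, j) ∈ S := by simp [S]
  let φ : (S → ℝ) → ℝ := fun y => y ⟨(a, j), ha⟩ * y ⟨(b, j), hb⟩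
  -- Rebuilds the matrix with column `j` erased from the entries outside that column alone, so that
  -- independence of disjoint families applies.
  let f : (T → ℝ) → Matrix ι ι ℝ := fun y =>
    Matrix.of fun i l => if hl : l = j then 0 else y ⟨(i, l), by simp [T, hl]⟩
  have hf : Continuous f := by
    refine continuous_matrix fun i l => ?_
    simp only [f, of_apply]
    split_ifs
    · exact continuous_const
    · exact continuous_apply _
  let ψ : (T → ℝ) → ℝ := fun y => ((f y * (f y)ᵀ) ^ K) a b
  have hψ : Continuous ψ := ((hf.matrix_mul hf.matrix_transpose).pow K).matrix_elem a b
  have hφ : Continuous φ := (continuous_apply _).mul (continuous_apply _)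
  have := hind.comp hφ.measurable hψ.measurable
  have e : ∀ ω, f (fun i : T => x i ω) = (noiseMatrix x ω).updateCol j 0 := by
    intro ω
    ext i l
    simp only [f, of_apply, updateCol_apply, noiseMatrix, Pi.zero_apply]
    split_ifs <;> rfl
  have e2 : (fun ω => ((gramWithout (noiseMatrix x ω) j) ^ K) a b)
      = ψ ∘ fun ω (i : T) => x i ω := by
    ext ω
    simp only [Function.comp, ψ, e]
    rfl
  rw [e2]
  exact this

/-- After the expectation is factored, the off-diagonal terms vanish because distinct entries of the
column are independent and centred; each diagonal term costs one variance. -/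
theorem NoiseFamily.integral_column_quad_le (h : NoiseFamily μ x v) (j : ι) (K : ℕ) :
    ∫ ω, (fun i => x (i, j) ω) ⬝ᵥ ((gramWithout (noiseMatrix x ω) j) ^ K) *ᵥ (fun i => x (i, j) ω) ∂μ
      ≤ v * ∫ ω, ((gramWithout (noiseMatrix x ω) j) ^ K).trace ∂μ := by
  have hint : ∀ a b : ι, Integrable (fun ω => x (a, j) ω * x (b, j) ω
      * ((gramWithout (noiseMatrix x ω) j) ^ K) a b) μ := fun a b =>
    h.integrable_continuous (F := fun y => y (a, j) * y (b, j) *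
      (((Matrix.of fun i l => y (i, l)).updateCol j 0 *
        ((Matrix.of fun i l => y (i, l)).updateCol j 0)ᵀ) ^ K) a b)
      (((continuous_apply (a, j)).fun_mul (continuous_apply (b, j))).fun_mul
        (continuous_gram_pow_entry K a b _ (continuous_gramWithout j)))
  have e : ∀ ω, (fun i => x (i, j) ω) ⬝ᵥ ((gramWithout (noiseMatrix x ω) j) ^ K)
      *ᵥ (fun i => x (i, j) ω) = ∑ a, ∑ b, x (a, j) ω * x (b, j) ω
      * ((gramWithout (noiseMatrix x ω) j) ^ K) a b := by
    intro ω
    simp only [dotProduct, mulVec, Finset.mul_sum]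
    exact Finset.sum_congr rfl fun a _ => Finset.sum_congr rfl fun b _ => by ring
  simp_rw [e]
  rw [integral_finsetSum _ fun a _ => integrable_finsetSum _ fun b _ => hint a b]
  simp_rw [Matrix.trace, diag_apply]
  rw [integral_finsetSum _ fun a _ => h.integrable_gramWithout_pow j K a a, Finset.mul_sum]
  refine Finset.sum_le_sum fun a _ => ?_
  rw [integral_finsetSum _ fun b _ => hint a b]
  have hterm : ∀ b, ∫ ω, x (a, j) ω * x (b, j) ω * ((gramWithout (noiseMatrix x ω) j) ^ K) a b ∂μ
      = (∫ ω, x (a, j) ω * x (b, j) ω ∂μ)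
        * ∫ ω, ((gramWithout (noiseMatrix x ω) j) ^ K) a b ∂μ := fun b =>
    (h.indep_column j K a b).integral_fun_mul_eq_mul_integral
      ((h.measurable _).mul (h.measurable _)).aestronglyMeasurable
      (h.integrable_gramWithout_pow j K a b).aestronglyMeasurable
  have hzero : ∀ b, b ≠ a → ∫ ω, x (a, j) ω * x (b, j) ω ∂μ = 0 := by
    intro b hb
    have := (h.indep.indepFun (i := (a, j)) (j := (b, j)) (by simp [hb.symm]))
    rw [this.integral_fun_mul_eq_mul_integral (h.measurable _).aestronglyMeasurable
      (h.measurable _).aestronglyMeasurable, h.mean, zero_mul]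
  rw [Finset.sum_eq_single a (fun b _ hb => by rw [hterm, hzero b hb, zero_mul]) (by simp), hterm]
  refine mul_le_mul_of_nonneg_right ?_ (integral_nonneg fun ω => ?_)
  · simpa [sq] using h.variance_le (a, j)
  · exact ((gram_posSemidef _).pow K).diag_nonneg

omit [DecidableEq ι] in
-- With `S` the squared norm of the column, `S ^ K ≤ K! exp S`. The exponential moment factors over
-- the entries, and `exp y ≤ 1 + 2y` on `[0, 1]` bounds each factor.
theorem NoiseFamily.integral_column_norm_le (h : NoiseFamily μ x v) (j : ι) (K : ℕ) :
    ∫ ω, ((fun i => x (i, j) ω) ⬝ᵥ (fun i => x (i, j) ω)) ^ K ∂μ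
      ≤ K.factorial * Real.exp (2 * v * Fintype.card ι) := by
  have hind : iIndepFun (fun i ω => x (i, j) ω ^ 2) μ :=
    (h.indep.precomp (g := fun i : ι => (i, j)) (fun a b hab => by simpa using hab)).comp
      (fun _ y => y ^ 2) fun _ => by fun_prop
  have hmgf := hind.mgf_sum (t := 1) (fun i => (h.measurable _).pow_const 2) Finset.univ
  have h1 : ∀ i, mgf (fun ω => x (i, j) ω ^ 2) μ 1 ≤ Real.exp (2 * v) := by
    intro i
    have hle : ∀ ω, Real.exp (1 * x (i, j) ω ^ 2) ≤ 1 + 2 * x (i, j) ω ^ 2 := by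
      intro ω
      have hx := h.abs_le_one (i, j) ω
      have h2 : x (i, j) ω ^ 2 ≤ 1 := by rw [← sq_abs]; nlinarith [abs_nonneg (x (i, j) ω)]
      have h3 := Real.abs_exp_sub_one_sub_id_le (x := x (i, j) ω ^ 2)
        (by rw [abs_of_nonneg (sq_nonneg _)]; exact h2)
      have h4 := (abs_le.1 h3).2
      rw [one_mul]
      nlinarith [sq_nonneg (x (i, j) ω)]
    have hi2 : Integrable (fun ω => x (i, j) ω ^ 2) μ :=
      h.integrable_continuous (F := fun y => y (i, j) ^ 2) (by fun_prop)
    calc mgf (fun ω => x (i, j) ω ^ 2) μ 1 ≤ ∫ ω, (1 + 2 * x (i, j) ω ^ 2) ∂μ :=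
          integral_mono (h.integrable_continuous (F := fun y => Real.exp (1 * y (i, j) ^ 2))
            (by fun_prop)) ((integrable_const _).add (hi2.const_mul 2)) hle
      _ = 1 + 2 * ∫ ω, x (i, j) ω ^ 2 ∂μ := by
          rw [integral_add (integrable_const _) (hi2.const_mul 2), integral_const_mul]; simp
      _ ≤ 1 + 2 * v := by linarith [h.variance_le (i, j)]
      _ ≤ _ := by linarith [Real.add_one_le_exp (2 * v)]
  have h2 : ∫ ω, Real.exp (∑ i, x (i, j) ω ^ 2) ∂μ ≤ Real.exp (2 * v * Fintype.card ι) := by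
    have e : ∫ ω, Real.exp (∑ i, x (i, j) ω ^ 2) ∂μ
        = mgf (∑ i, fun ω => x (i, j) ω ^ 2) μ 1 := by
      simp [mgf]
    rw [e, hmgf]
    calc _ ≤ ∏ _i : ι, Real.exp (2 * v) :=
          Finset.prod_le_prod (fun i _ => mgf_nonneg) fun i _ => h1 i
      _ = _ := by
          rw [Finset.prod_const, Finset.card_univ, ← Real.exp_nat_mul]; ring_nf
  calc ∫ ω, ((fun i => x (i, j) ω) ⬝ᵥ (fun i => x (i, j) ω)) ^ K ∂μ
      ≤ ∫ ω, K.factorial * Real.exp (∑ i, x (i, j) ω ^ 2) ∂μ := by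
        refine integral_mono
          (h.integrable_continuous (F := fun y => ((fun i => y (i, j)) ⬝ᵥ fun i => y (i, j)) ^ K)
            (by simp only [dotProduct]; fun_prop))
          (h.integrable_continuous (F := fun y => K.factorial * Real.exp (∑ i, y (i, j) ^ 2))
            (by fun_prop)) fun ω => ?_
        have e : (fun i => x (i, j) ω) ⬝ᵥ (fun i => x (i, j) ω) = ∑ i, x (i, j) ω ^ 2 := by
          simp [dotProduct, sq]
        simp only [e]
        have := Real.pow_div_factorial_le_exp (x := ∑ i, x (i, j) ω ^ 2)
          (Finset.sum_nonneg fun i _ => sq_nonneg _) K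
        rwa [div_le_iff₀' (by positivity)] at this
    _ = K.factorial * ∫ ω, Real.exp (∑ i, x (i, j) ω ^ 2) ∂μ := integral_const_mul _ _
    _ ≤ _ := by gcongr

/-- One step of the recursion: expand the trace over columns, separate each column from its
complement by `rankOne_moment_le`, average over the column, and restore the full Gram matrix by
`trace_pow_mono`. -/
theorem NoiseFamily.trace_moment_succ_le (h : NoiseFamily μ x v) (hv : 0 ≤ v) {θ : ℝ}
    (hθ : 0 < θ) (K : ℕ) :
    ∫ ω, ((noiseMatrix x ω * (noiseMatrix x ω)ᵀ) ^ (K + 1)).trace ∂μ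
      ≤ (1 + θ) ^ K * (v * Fintype.card ι)
          * ∫ ω, ((noiseMatrix x ω * (noiseMatrix x ω)ᵀ) ^ K).trace ∂μ
        + Fintype.card ι * ((1 + θ⁻¹) ^ K
          * ((K + 1).factorial * Real.exp (2 * v * Fintype.card ι))) := by
  have hq : ∀ j, Integrable (fun ω => (fun i => x (i, j) ω) ⬝ᵥ
      ((gramWithout (noiseMatrix x ω) j) ^ K) *ᵥ (fun i => x (i, j) ω)) μ := by
    intro j
    have hc := fun a b => continuous_gram_pow_entry K a b _ (continuous_gramWithout (ι := ι) j)
    refine h.integrable_continuous (F := fun y => (fun i => y (i, j)) ⬝ᵥ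
      ((gramWithout (Matrix.of fun i l => y (i, l)) j) ^ K) *ᵥ (fun i => y (i, j))) ?_
    simp only [dotProduct, mulVec]
    exact continuous_finsetSum _ fun a _ => (continuous_apply _).mul
      (continuous_finsetSum _ fun b _ => (hc a b).mul (continuous_apply _))
  have hs : ∀ j, Integrable (fun ω =>
      ((fun i => x (i, j) ω) ⬝ᵥ (fun i => x (i, j) ω)) ^ (K + 1)) μ := fun j =>
    h.integrable_continuous (F := fun y => ((fun i => y (i, j)) ⬝ᵥ fun i => y (i, j)) ^ (K + 1))
      (by simp only [dotProduct]; fun_prop)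
  have hmono : ∀ j, ∫ ω, ((gramWithout (noiseMatrix x ω) j) ^ K).trace ∂μ
      ≤ ∫ ω, ((noiseMatrix x ω * (noiseMatrix x ω)ᵀ) ^ K).trace ∂μ := by
    intro j
    refine integral_mono (integrable_finsetSum _ fun a _ => h.integrable_gramWithout_pow j K a a)
      (h.integrable_gram_pow_trace K) fun ω => ?_
    have := trace_pow_mono (N := gramWithout (noiseMatrix x ω) j) (gram_posSemidef _)
      (fun i => noiseMatrix x ω i j) K
    rwa [gramWithout_add] at this
  calc ∫ ω, ((noiseMatrix x ω * (noiseMatrix x ω)ᵀ) ^ (K + 1)).trace ∂μ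
      ≤ ∫ ω, ∑ j, ((1 + θ) ^ K * ((fun i => x (i, j) ω) ⬝ᵥ
        ((gramWithout (noiseMatrix x ω) j) ^ K) *ᵥ (fun i => x (i, j) ω)) +
        (1 + θ⁻¹) ^ K * ((fun i => x (i, j) ω) ⬝ᵥ (fun i => x (i, j) ω)) ^ (K + 1)) ∂μ := by
        refine integral_mono (h.integrable_gram_pow_trace _) (integrable_finsetSum _ fun j _ =>
          ((hq j).const_mul _).add ((hs j).const_mul _)) fun ω => ?_
        simp only
        rw [trace_gram_pow_succ]
        refine Finset.sum_le_sum fun j _ => ?_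
        have := rankOne_moment_le (N := gramWithout (noiseMatrix x ω) j) (gram_posSemidef _)
          (fun i => noiseMatrix x ω i j) hθ K
        rwa [gramWithout_add] at this
    _ = ∑ j, ((1 + θ) ^ K * ∫ ω, ((fun i => x (i, j) ω) ⬝ᵥ
        ((gramWithout (noiseMatrix x ω) j) ^ K) *ᵥ (fun i => x (i, j) ω)) ∂μ +
        (1 + θ⁻¹) ^ K * ∫ ω, ((fun i => x (i, j) ω) ⬝ᵥ (fun i => x (i, j) ω)) ^ (K + 1) ∂μ) := by
        rw [integral_finsetSum _ fun j _ => ((hq j).const_mul _).fun_add ((hs j).const_mul _)]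
        refine Finset.sum_congr rfl fun j _ => ?_
        rw [integral_add ((hq j).const_mul _) ((hs j).const_mul _), integral_const_mul,
          integral_const_mul]
    _ ≤ ∑ _j : ι, ((1 + θ) ^ K * (v *
          ∫ ω, ((noiseMatrix x ω * (noiseMatrix x ω)ᵀ) ^ K).trace ∂μ) +
        (1 + θ⁻¹) ^ K * ((K + 1).factorial * Real.exp (2 * v * Fintype.card ι))) := by
        refine Finset.sum_le_sum fun j _ => ?_
        have h1 := (h.integral_column_quad_le j K).trans
          (mul_le_mul_of_nonneg_left (hmono j) hv)
        have h2 := h.integral_column_norm_le j (K + 1)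
        gcongr
    _ = _ := by
        rw [Finset.sum_const, Finset.card_univ, nsmul_eq_mul]; ring

/-- The trace moment bound for a matrix with independent centred entries. -/
theorem NoiseFamily.trace_moment_le (h : NoiseFamily μ x v) (hv : 0 ≤ v) {θ : ℝ} (hθ : 0 < θ)
    {k K : ℕ} (hk : 1 ≤ k) (hK : K ≤ k) :
    ∫ ω, ((noiseMatrix x ω * (noiseMatrix x ω)ᵀ) ^ K).trace ∂μ
      ≤ Fintype.card ι * Real.exp (2 * v * Fintype.card ι)
        * ((1 + θ) ^ k * (v * Fintype.card ι) + (1 + θ⁻¹) * k) ^ K := by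
  -- Both `P` and `Z` are taken at the final power `k`, so that the recursion has constant
  -- coefficients for all `K ≤ k`.
  set P := (1 + θ) ^ k * (v * Fintype.card ι)
  set Z := (1 + θ⁻¹) * (k : ℝ)
  have hP : 0 ≤ P := by positivity
  have hZ : 0 ≤ Z := by positivity
  have hn : (0 : ℝ) ≤ Fintype.card ι := Nat.cast_nonneg _
  induction K with
  | zero =>
    simp only [pow_zero, trace_one, mul_one, integral_const, smul_eq_mul]
    rw [measureReal_def, measure_univ, ENNReal.toReal_one, one_mul]
    exact le_mul_of_one_le_right hn (Real.one_le_exp (by positivity))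
  | succ K ih =>
    refine (h.trace_moment_succ_le hv hθ K).trans ?_
    have ih' := ih (by omega)
    have h1 : (1 + θ) ^ K * (v * Fintype.card ι) ≤ P := by
      have : (1 + θ) ^ K ≤ (1 + θ) ^ k := pow_le_pow_right₀ (by linarith) (by omega)
      exact mul_le_mul_of_nonneg_right this (by positivity)
    have h2 : (1 + θ⁻¹) ^ K * ((K + 1).factorial : ℝ) ≤ Z ^ (K + 1) := by
      have a1 : ((K + 1).factorial : ℝ) ≤ (k : ℝ) ^ (K + 1) := by
        have : (K + 1).factorial ≤ k ^ (K + 1) :=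
          (Nat.factorial_le_pow (K + 1)).trans (Nat.pow_le_pow_left hK _)
        exact_mod_cast this
      have a2 : (1 + θ⁻¹) ^ K ≤ (1 + θ⁻¹) ^ (K + 1) :=
        pow_le_pow_right₀ (by have := inv_pos.2 hθ; linarith) (Nat.le_succ K)
      rw [mul_pow]
      exact mul_le_mul a2 a1 (Nat.cast_nonneg _) (by positivity)
    have h3 : Z ^ (K + 1) ≤ Z * (P + Z) ^ K := by
      rw [pow_succ']
      exact mul_le_mul_of_nonneg_left (pow_le_pow_left₀ hZ (by linarith) K) hZ
    have hE := Real.exp_pos (2 * v * Fintype.card ι)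
    have h4 : 0 ≤ ∫ ω, ((noiseMatrix x ω * (noiseMatrix x ω)ᵀ) ^ K).trace ∂μ :=
      integral_nonneg fun ω => ((gram_posSemidef _).pow K).trace_nonneg
    calc _ ≤ P * (Fintype.card ι * Real.exp (2 * v * Fintype.card ι) * (P + Z) ^ K)
          + Fintype.card ι * ((Z * (P + Z) ^ K) * Real.exp (2 * v * Fintype.card ι)) := by
          refine add_le_add (mul_le_mul h1 ih' h4 hP) ?_
          rw [← mul_assoc ((1 + θ⁻¹) ^ K)]
          exact mul_le_mul_of_nonneg_left
            (mul_le_mul_of_nonneg_right (h2.trans h3) hE.le) hn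
      _ = _ := by ring

theorem NoiseFamily.measure_trace_gt_le (h : NoiseFamily μ x v) (hv : 0 ≤ v) {θ : ℝ} (hθ : 0 < θ)
    {k : ℕ} (hk : 1 ≤ k) {L : ℝ} (hL : 0 < L) :
    μ {ω | L ^ k < ((noiseMatrix x ω * (noiseMatrix x ω)ᵀ) ^ k).trace}
      ≤ ENNReal.ofReal (Fintype.card ι * Real.exp (2 * v * Fintype.card ι)
        * (((1 + θ) ^ k * (v * Fintype.card ι) + (1 + θ⁻¹) * k) / L) ^ k) := by
  have hm := mul_meas_ge_le_integral_of_nonneg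
    (μ := μ) (f := fun ω => ((noiseMatrix x ω * (noiseMatrix x ω)ᵀ) ^ k).trace)
    (Filter.Eventually.of_forall fun ω => ((gram_posSemidef _).pow k).trace_nonneg)
    (h.integrable_gram_pow_trace k) (L ^ k)
  have h1 := h.trace_moment_le hv hθ hk le_rfl
  have h2 : μ.real {ω | L ^ k ≤ ((noiseMatrix x ω * (noiseMatrix x ω)ᵀ) ^ k).trace}
      ≤ Fintype.card ι * Real.exp (2 * v * Fintype.card ι)
        * (((1 + θ) ^ k * (v * Fintype.card ι) + (1 + θ⁻¹) * k) / L) ^ k := by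
    rw [div_pow, ← mul_div_assoc, le_div_iff₀' (by positivity)]
    exact hm.trans h1
  calc μ {ω | L ^ k < ((noiseMatrix x ω * (noiseMatrix x ω)ᵀ) ^ k).trace}
      ≤ μ {ω | L ^ k ≤ ((noiseMatrix x ω * (noiseMatrix x ω)ᵀ) ^ k).trace} :=
        measure_mono fun ω (hω : L ^ k < _) => show L ^ k ≤ _ from hω.le
    _ = ENNReal.ofReal (μ.real _) := (ofReal_measureReal).symm
    _ ≤ _ := ENNReal.ofReal_le_ofReal h2

end MomentBound
end GPM

namespace GPM
open Matrix MeasureTheory ProbabilityTheory Filter Topology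

/-! ### Choice of the power and the resulting norm bound -/

section Asymptotics

/-- Here `w` stands for variance times dimension. Once the base of the power falls below `exp (-(2B
+ 3))`, raising it to the power `⌈log n⌉` beats `n exp (2w)` and leaves `n ^ (-2)`. -/
theorem exists_moment_parameters (B η : ℝ) (hη : 0 < η) :
    ∃ N : ℕ, ∀ n : ℕ, N ≤ n → ∃ θ : ℝ, 0 < θ ∧ 0 < Real.log n ∧ 1 ≤ ⌈Real.log n⌉₊ ∧
      ∀ w : ℝ, 0 ≤ w → w ≤ B * Real.log n →
        n * Real.exp (2 * w) * (((1 + θ) ^ ⌈Real.log n⌉₊ * w + (1 + θ⁻¹) * ⌈Real.log n⌉₊)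
          / (η * Real.log n) ^ 2) ^ ⌈Real.log n⌉₊ ≤ (n : ℝ) ^ (-2 : ℝ) := by
  have hlim : Tendsto (fun l : ℝ => B / η ^ 2 * (√l)⁻¹ + 2 / η ^ 2 * l⁻¹
      + 8 / η ^ 2 * (Real.log l)⁻¹) atTop (𝓝 0) := by
    have h1 : Tendsto (fun l : ℝ => (√l)⁻¹) atTop (𝓝 0) :=
      tendsto_inv_atTop_zero.comp Real.tendsto_sqrt_atTop
    have h2 : Tendsto (fun l : ℝ => l⁻¹) atTop (𝓝 0) := tendsto_inv_atTop_zero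
    have h3 : Tendsto (fun l : ℝ => (Real.log l)⁻¹) atTop (𝓝 0) :=
      tendsto_inv_atTop_zero.comp Real.tendsto_log_atTop
    simpa using ((h1.const_mul (B / η ^ 2)).add (h2.const_mul (2 / η ^ 2))).add
      (h3.const_mul (8 / η ^ 2))
  have hev : ∀ᶠ l : ℝ in atTop, B / η ^ 2 * (√l)⁻¹ + 2 / η ^ 2 * l⁻¹
      + 8 / η ^ 2 * (Real.log l)⁻¹ ≤ Real.exp (-(2 * B + 3)) ∧ 3 ≤ l :=
    (hlim.eventually_le_const (Real.exp_pos _)).and (eventually_ge_atTop 3)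
  have hn := (Real.tendsto_log_atTop.comp tendsto_natCast_atTop_atTop).eventually hev
  obtain ⟨N, hN⟩ := eventually_atTop.1 (hn.and (eventually_ge_atTop 1))
  refine ⟨N, fun n hn => ?_⟩
  obtain ⟨⟨hr, hl3⟩, hn1⟩ := hN n hn
  simp only [Function.comp] at hr hl3
  set l := Real.log n with hl
  have hl0 : 0 < l := by linarith
  have hll : 0 < Real.log l := Real.log_pos (by linarith)
  have hnpos : (0 : ℝ) < n := by exact_mod_cast hn1
  set k := ⌈l⌉₊ with hk
  have hk1 : l ≤ k := Nat.le_ceil l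
  have hk2 : (k : ℝ) ≤ 2 * l := by
    have := Nat.ceil_lt_add_one hl0.le
    linarith
  have hkpos : 1 ≤ k := Nat.one_le_iff_ne_zero.2 (by
    intro h0; rw [h0] at hk1; simp at hk1; linarith)
  -- Small enough that `(1 + θ) ^ k ≤ √l`, large enough that `θ⁻¹ k`, which is at most `8 l² / log
  -- l`, is still `o(l²)`; the threshold is `(η l)²`.
  set θ := Real.log l / (4 * l) with hθ
  have hθ0 : 0 < θ := by positivity
  refine ⟨θ, hθ0, hl0, hkpos, fun w hw0 hw => ?_⟩
  have hB : 0 ≤ B := by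
    by_contra hneg
    push Not at hneg
    nlinarith
  have hP : (1 + θ) ^ k ≤ √l := by
    calc (1 + θ) ^ k ≤ Real.exp θ ^ k :=
          pow_le_pow_left₀ (by positivity) (by linarith [Real.add_one_le_exp θ]) _
      _ = Real.exp (k * θ) := (Real.exp_nat_mul θ k).symm
      _ ≤ Real.exp (Real.log l / 2) := by
          refine Real.exp_le_exp.2 ?_
          calc (k : ℝ) * θ ≤ 2 * l * θ := mul_le_mul_of_nonneg_right hk2 hθ0.le
            _ = _ := by rw [hθ]; field_simp; ring
      _ = √l := by
          rw [← Real.log_sqrt hl0.le, Real.exp_log (Real.sqrt_pos.2 hl0)]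
  have hsq : √l * √l = l := Real.mul_self_sqrt hl0.le
  have hs0 : 0 < √l := Real.sqrt_pos.2 hl0
  set r := ((1 + θ) ^ k * w + (1 + θ⁻¹) * k) / (η * l) ^ 2 with hrdef
  have hr0 : 0 ≤ r := by positivity
  have hr1 : r ≤ Real.exp (-(2 * B + 3)) := by
    refine le_trans ?_ hr
    rw [hrdef, div_le_iff₀ (by positivity)]
    have e : (B / η ^ 2 * (√l)⁻¹ + 2 / η ^ 2 * l⁻¹ + 8 / η ^ 2 * (Real.log l)⁻¹) * (η * l) ^ 2
        = √l * (B * l) + (1 + θ⁻¹) * (2 * l) := by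
      have e1 : (√l)⁻¹ * l = √l := by rw [inv_mul_eq_iff_eq_mul₀ hs0.ne', hsq]
      have e2 : B / η ^ 2 * (√l)⁻¹ * (η * l) ^ 2 = B * l * ((√l)⁻¹ * l) := by field_simp
      rw [add_mul, add_mul, e2, e1, hθ]
      field_simp
      ring
    rw [e]
    have h1 : (1 + θ) ^ k * w ≤ √l * (B * l) := mul_le_mul hP hw hw0 hs0.le
    have h2 : (1 + θ⁻¹) * (k : ℝ) ≤ (1 + θ⁻¹) * (2 * l) :=
      mul_le_mul_of_nonneg_left hk2 (by positivity)
    linarith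
  calc n * Real.exp (2 * w) * r ^ k
      ≤ Real.exp l * Real.exp (2 * (B * l)) * Real.exp (-(2 * B + 3)) ^ k := by
        rw [hl, Real.exp_log hnpos, ← hl]
        gcongr
    _ = Real.exp (l + 2 * (B * l) + k * (-(2 * B + 3))) := by
        rw [Real.exp_add, Real.exp_add, Real.exp_nat_mul]
    _ ≤ Real.exp (l * (-2)) := by
        refine Real.exp_le_exp.2 ?_
        nlinarith
    _ = (n : ℝ) ^ (-2 : ℝ) := by rw [Real.rpow_def_of_pos hnpos]

/-- The bilinear form of `N` is bounded by `τ` times the product of the Euclidean norms. -/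
def BilinBound {ι κ : Type*} [Fintype ι] [Fintype κ] (N : Matrix ι κ ℝ) (τ : ℝ) : Prop :=
  ∀ x y, |x ⬝ᵥ N *ᵥ y| ≤ τ * (√(x ⬝ᵥ x) * √(y ⬝ᵥ y))

theorem abs_dotProduct_le {ι : Type*} [Fintype ι] (x y : ι → ℝ) :
    |x ⬝ᵥ y| ≤ √(x ⬝ᵥ x) * √(y ⬝ᵥ y) := by
  rw [← Real.sqrt_mul (dotProduct_self_nonneg x)]
  refine Real.abs_le_sqrt ?_
  simpa [dotProduct, sq] using Finset.sum_mul_sq_le_sq_mul_sq Finset.univ x y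

theorem BilinBound.of_trace {ι ι' : Type*} [Fintype ι] [DecidableEq ι] [Fintype ι']
    {T : Matrix ι ι' ℝ}
    {τ : ℝ} (hτ : 0 ≤ τ) {k : ℕ} (hk : k ≠ 0) (h : ((T * Tᵀ) ^ k).trace ≤ (τ ^ 2) ^ k) :
    BilinBound T τ := by
  intro x y
  have h1 := quad_le_of_trace_pow_le (gram_posSemidef T) hk (sq_nonneg τ) h x
  have e : x ⬝ᵥ (T * Tᵀ) *ᵥ x = (Tᵀ *ᵥ x) ⬝ᵥ (Tᵀ *ᵥ x) := by
    rw [← mulVec_mulVec, dotProduct_mulVec, ← mulVec_transpose]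
  rw [e] at h1
  rw [dotProduct_mulVec, ← mulVec_transpose]
  refine (abs_dotProduct_le _ _).trans ?_
  rw [← mul_assoc]
  refine mul_le_mul_of_nonneg_right ?_ (Real.sqrt_nonneg _)
  refine (Real.sqrt_le_sqrt h1).trans ?_
  rw [Real.sqrt_mul (sq_nonneg τ), Real.sqrt_sq hτ]

theorem exists_noise_bound (B η : ℝ) (hη : 0 < η) :
    ∃ N : ℕ, ∀ n : ℕ, N ≤ n → 0 < Real.log n ∧
      ∀ {Ω : Type*} [MeasurableSpace Ω] (μ : Measure Ω) [IsProbabilityMeasure μ]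
        (x : Fin n × Fin n → Ω → ℝ) (v : ℝ), NoiseFamily μ x v → 0 ≤ v → v * n ≤ B * Real.log n →
        μ {ω | ¬ BilinBound (noiseMatrix x ω) (η * Real.log n)}
          ≤ ENNReal.ofReal ((n : ℝ) ^ (-2 : ℝ)) := by
  obtain ⟨N, hN⟩ := exists_moment_parameters B η hη
  refine ⟨N, fun n hn => ?_⟩
  obtain ⟨θ, hθ, hl, hk, hb⟩ := hN n hn
  refine ⟨hl, fun μ _ x v hx hv hvn => ?_⟩
  have hL : 0 < (η * Real.log n) ^ 2 := by positivity
  have h1 := hx.measure_trace_gt_le hv hθ hk hL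
  rw [Fintype.card_fin, mul_assoc 2 v] at h1
  refine (measure_mono ?_).trans (h1.trans (ENNReal.ofReal_le_ofReal (hb _ (by positivity) hvn)))
  intro ω hω
  by_contra hc
  exact hω (BilinBound.of_trace (by positivity) (by omega) (not_lt.1 hc))

end Asymptotics
end GPM

namespace GPM
open Matrix MeasureTheory ProbabilityTheory

/-! ### The block model: centring and independence of the entries -/

section Model

instance isProbabilityMeasure_unif (d : ℕ) (κ : GroupKind) : IsProbabilityMeasure (unif d κ) :=
  ⟨by
    have h := Measure.haarMeasure_self (G := groupOf d κ) (K₀ := ⊤)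
    rwa [TopologicalSpace.PositiveCompacts.coe_top] at h⟩

instance isMulLeftInvariant_unif (d : ℕ) (κ : GroupKind) : (unif d κ).IsMulLeftInvariant := by
  unfold unif; infer_instance

theorem toMat_mul_transpose {d : ℕ} {κ : GroupKind} (g : groupOf d κ) :
    toMat g * (toMat g)ᵀ = 1 :=
  ((mem_OGroup_iff _).1 (g : OGroup d).2).1

theorem toMat_transpose_mul {d : ℕ} {κ : GroupKind} (g : groupOf d κ) :
    (toMat g)ᵀ * toMat g = 1 :=
  ((mem_OGroup_iff _).1 (g : OGroup d).2).2

theorem toMat_mul {d : ℕ} {κ : GroupKind} (g h : groupOf d κ) :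
    toMat (g * h) = toMat g * toMat h := rfl

theorem abs_orthogonal_entry_le {d : ℕ} {U : Matrix (Fin d) (Fin d) ℝ} (hU : U ∈ OGroup d)
    (a b : Fin d) : |U a b| ≤ 1 :=
  entry_norm_bound_of_unitary (𝕜 := ℝ) hU a b

theorem abs_toMat_le {d : ℕ} {κ : GroupKind} (g : groupOf d κ) (a b : Fin d) :
    |toMat g a b| ≤ 1 :=
  abs_orthogonal_entry_le (g : OGroup d).2 a b

theorem measurable_toMat_entry {d : ℕ} {κ : GroupKind} (a b : Fin d) :
    Measurable fun g : groupOf d κ => toMat g a b :=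
  (continuous_toMat.matrix_elem a b).measurable

/-- Some group element flips the sign of a given row, unless the group is trivial. -/
theorem exists_signFlip {d : ℕ} {κ : GroupKind} (h : ¬ (d = 1 ∧ κ = .specialOrthogonal))
    (a : Fin d) : ∃ g : groupOf d κ, ∀ (x : groupOf d κ) b, toMat (g * x) a b = - toMat x a b := by
  have key : ∀ s : Fin d → ℝ, (∀ i, s i * s i = 1) → s a = -1 →
      (κ = .specialOrthogonal → ∏ i, s i = 1) →
      ∃ g : groupOf d κ, ∀ (x : groupOf d κ) b, toMat (g * x) a b = - toMat x a b := by
    intro s hs ha hdet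
    have hO : diagonal s ∈ OGroup d := by
      rw [mem_OGroup_iff, diagonal_transpose, diagonal_mul_diagonal]
      simp [hs]
    have hG : (⟨diagonal s, hO⟩ : OGroup d) ∈ groupOf d κ := by
      cases κ with
      | orthogonal => exact Subgroup.mem_top _
      | specialOrthogonal =>
        change _ ∈ (detHom d).ker
        rw [MonoidHom.mem_ker]
        change (diagonal s).det = 1
        rw [det_diagonal, hdet rfl]
    refine ⟨⟨_, hG⟩, fun x b => ?_⟩
    rw [toMat_mul]
    change (diagonal s * toMat x) a b = _
    rw [diagonal_mul, ha]
    ring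
  by_cases hκ : κ = .orthogonal
  · refine key (fun _ => -1) (fun _ => by norm_num) rfl (fun h2 => ?_)
    rw [hκ] at h2; cases h2
  · have hκ' : κ = .specialOrthogonal := by cases κ <;> simp_all
    have hd : d ≠ 1 := fun h1 => h ⟨h1, hκ'⟩
    obtain ⟨a', ha'⟩ : ∃ a' : Fin d, a' ≠ a := by
      by_contra hne
      push Not at hne
      apply hd
      have : Fintype.card (Fin d) = 1 := Fintype.card_eq_one_iff.2 ⟨a, hne⟩
      simpa using this
    -- A second sign is flipped to keep the determinant equal to 1.
    refine key (fun i => if i = a ∨ i = a' then -1 else 1) (fun i => by split_ifs <;> norm_num)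
      (by simp) (fun _ => ?_)
    rw [Finset.prod_ite, Finset.prod_const, Finset.prod_const_one, mul_one]
    have : (Finset.univ.filter fun i : Fin d => i = a ∨ i = a') = {a, a'} := by
      ext i; simp
    rw [this, Finset.card_pair ha'.symm]
    norm_num

/-- The mean of the uniform distribution on the group. -/
noncomputable def meanMat (d : ℕ) (κ : GroupKind) : Matrix (Fin d) (Fin d) ℝ :=
  Matrix.of fun a b => ∫ g, toMat g a b ∂(unif d κ)

theorem toMat_eq_one {g : groupOf 1 .specialOrthogonal} : toMat g = 1 := by
  have h : detHom 1 (g : OGroup 1) = 1 := (MonoidHom.mem_ker).1 g.2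
  have h2 : (toMat g).det = 1 := h
  rw [det_fin_one] at h2
  ext i j
  obtain rfl := Subsingleton.elim i 0
  obtain rfl := Subsingleton.elim j 0
  simpa using h2

/-- Invariance of the Haar measure under a sign flip of row `a` makes each mean in that row equal to
its own negative. -/
theorem meanMat_eq_zero {d : ℕ} {κ : GroupKind} (h : ¬ (d = 1 ∧ κ = .specialOrthogonal)) :
    meanMat d κ = 0 := by
  ext a b
  obtain ⟨g, hg⟩ := exists_signFlip h a
  have h1 := integral_mul_left_eq_self (μ := unif d κ) (fun x => toMat x a b) g
  simp only [hg, integral_neg] at h1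
  simp only [meanMat, of_apply, Matrix.zero_apply]
  linarith

theorem meanMat_eq_one : meanMat 1 .specialOrthogonal = 1 := by
  ext a b
  simp [meanMat, toMat_eq_one]

theorem meanMat_transpose (d : ℕ) (κ : GroupKind) : (meanMat d κ)ᵀ = meanMat d κ := by
  by_cases h : d = 1 ∧ κ = .specialOrthogonal
  · obtain ⟨rfl, rfl⟩ := h
    rw [meanMat_eq_one, transpose_one]
  · rw [meanMat_eq_zero h, transpose_zero]

/-- This dichotomy is what keeps centred edge entries bounded by 1: in general, subtracting the mean
of a variable with values in `[-1, 1]` could double its size. -/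
theorem mean_or_const {d : ℕ} (κ : GroupKind) (a b : Fin d) :
    (∃ c, ∀ g : groupOf d κ, toMat g a b = c) ∨ ∫ g, toMat g a b ∂(unif d κ) = 0 := by
  by_cases h : d = 1 ∧ κ = .specialOrthogonal
  · obtain ⟨rfl, rfl⟩ := h
    exact .inl ⟨_, fun g => by rw [toMat_eq_one]⟩
  · exact .inr (congrFun (congrFun (meanMat_eq_zero h) a) b)

section SingleEdge

variable {G : Type*} [MeasurableSpace G] {ν : Measure G} [IsProbabilityMeasure ν]

/-- The centred contribution of a single edge. -/
noncomputable def centredEdge (ν : Measure G) (P : ℝ) (h : G → ℝ) (z : Bool × G) : ℝ :=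
  (if z.1 = true then h z.2 else 0) - P * ∫ g, h g ∂ν

variable {P : unitInterval} {h : G → ℝ}

omit [IsProbabilityMeasure ν] in
theorem measurable_centredEdge (P : ℝ) (hm : Measurable h) : Measurable (centredEdge ν P h) := by
  unfold centredEdge
  refine Measurable.sub_const (Measurable.ite ?_ (hm.comp measurable_snd) measurable_const) _
  exact measurable_fst (measurableSet_singleton true)

theorem abs_centredEdge_le (hb : ∀ g, |h g| ≤ 1)
    (hc : (∃ c, ∀ g, h g = c) ∨ ∫ g, h g ∂ν = 0) (z : Bool × G) :
    |centredEdge ν P h z| ≤ 1 := by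
  have h0 := P.2.1
  have h1 := P.2.2
  unfold centredEdge
  rcases hc with ⟨c, hc⟩ | hc
  · have hcb : |c| ≤ 1 := hc z.2 ▸ hb z.2
    have e : ∫ g, h g ∂ν = c := by simp [hc]
    rw [e, hc]
    split_ifs
    · have : c - P * c = (1 - P) * c := by ring
      rw [this, abs_mul, abs_of_nonneg (by linarith : (0 : ℝ) ≤ 1 - P)]
      nlinarith [abs_nonneg c]
    · rw [zero_sub, abs_neg, abs_mul, abs_of_nonneg h0]
      nlinarith [abs_nonneg c]
  · rw [hc, mul_zero, sub_zero]
    split_ifs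
    · exact hb _
    · simp

theorem integral_edge (F : Bool × G → ℝ) (hF : Measurable F) (B : ℝ) (hB : ∀ z, |F z| ≤ B) :
    ∫ z, F z ∂((bernoulliMeasure true false P).prod ν)
      = P * ∫ g, F (true, g) ∂ν + (1 - P) * ∫ g, F (false, g) ∂ν := by
  have hi : Integrable F ((bernoulliMeasure true false P).prod ν) :=
    Integrable.of_bound hF.aestronglyMeasurable B (Filter.Eventually.of_forall hB)
  rw [integral_prod F hi, integral_bernoulliMeasure]
  simp

theorem integrable_of_abs_le_one (hm : Measurable h) (hb : ∀ g, |h g| ≤ 1) : Integrable h ν :=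
  Integrable.of_bound hm.aestronglyMeasurable 1 (Filter.Eventually.of_forall hb)

theorem integral_centredEdge (hm : Measurable h) (hb : ∀ g, |h g| ≤ 1)
    (hc : (∃ c, ∀ g, h g = c) ∨ ∫ g, h g ∂ν = 0) :
    ∫ z, centredEdge ν P h z ∂((bernoulliMeasure true false P).prod ν) = 0 := by
  rw [integral_edge _ (measurable_centredEdge _ hm) 1 (abs_centredEdge_le hb hc)]
  simp only [centredEdge, if_true, Bool.false_eq_true, if_false]
  rw [integral_sub (integrable_of_abs_le_one hm hb) (integrable_const _)]
  simp
  ring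

theorem integral_centredEdge_sq_le (hm : Measurable h) (hb : ∀ g, |h g| ≤ 1)
    (hc : (∃ c, ∀ g, h g = c) ∨ ∫ g, h g ∂ν = 0) :
    ∫ z, centredEdge ν P h z ^ 2 ∂((bernoulliMeasure true false P).prod ν) ≤ P := by
  have h0 := P.2.1
  have h1 := P.2.2
  rw [integral_edge _ ((measurable_centredEdge _ hm).pow_const 2) 1 (fun z => by
    rw [abs_of_nonneg (sq_nonneg _)]
    exact (sq_le_one_iff_abs_le_one _).2 (abs_centredEdge_le hb hc z))]
  simp only [centredEdge, if_true, Bool.false_eq_true, if_false]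
  rcases hc with ⟨c, hc⟩ | hc
  · have hG : Nonempty G := (inferInstance : NeZero ν).out |> fun hν => by
      by_contra hE
      rw [not_nonempty_iff] at hE
      exact hν (Measure.eq_zero_of_isEmpty ν)
    obtain ⟨g0⟩ := hG
    have hcb : c ^ 2 ≤ 1 := (sq_le_one_iff_abs_le_one _).2 (hc g0 ▸ hb g0)
    simp only [hc, integral_const, smul_eq_mul, measureReal_def, measure_univ,
      ENNReal.toReal_one, one_mul]
    have : (P : ℝ) * (c - P * c) ^ 2 + (1 - P) * (0 - P * c) ^ 2 = P * (1 - P) * c ^ 2 := by ring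
    rw [this]
    have h2 : (P : ℝ) * (1 - P) ≤ P := by nlinarith
    have h3 : 0 ≤ (P : ℝ) * (1 - P) := mul_nonneg h0 (by linarith)
    nlinarith [sq_nonneg c]
  · simp only [hc, mul_zero, sub_zero]
    have h2 : ∫ g, h g ^ 2 ∂ν ≤ 1 := by
      have : ∫ g, h g ^ 2 ∂ν ≤ ∫ _g, (1 : ℝ) ∂ν :=
        integral_mono_of_nonneg (Filter.Eventually.of_forall fun g => sq_nonneg _)
          (integrable_const _) (Filter.Eventually.of_forall fun g =>
            (sq_le_one_iff_abs_le_one _).2 (hb g))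
      simpa using this
    simp
    nlinarith

end SingleEdge

variable {n K d : ℕ} {κ : GroupKind}

/-- The edge probability of a pair, as a point of the unit interval. -/
noncomputable def edgeProb (p q : ℝ) (C : Fin n → Fin K) (e : Fin n × Fin n) : unitInterval :=
  Set.projIcc (0 : ℝ) 1 zero_le_one (if C e.1 = C e.2 then p else q)

/-- An entry of the block of an observed pair, as a function of the uniform group element. -/
noncomputable def edgeEntry (C : Fin n → Fin K) (R : Fin n → groupOf d κ) (a b : Fin d)
    (e : Fin n × Fin n) (g : groupOf d κ) : ℝ :=
  if C e.1 = C e.2 then (toMat (R e.1) * (toMat (R e.2))ᵀ) a b else toMat g a b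

/-- The centred entries `(a, b)` of the blocks above the diagonal. -/
noncomputable def edgeNoise (p q : ℝ) (C : Fin n → Fin K) (R : Fin n → groupOf d κ)
    (a b : Fin d) (e : Fin n × Fin n) (ω : Fin n × Fin n → Bool × groupOf d κ) : ℝ :=
  if e.1 < e.2 then centredEdge (unif d κ) (edgeProb p q C e) (edgeEntry C R a b e) (ω e) else 0

theorem orthogonal_mul_transpose_mem (g h : groupOf d κ) :
    toMat g * (toMat h)ᵀ ∈ OGroup d := by
  rw [mem_OGroup_iff, transpose_mul, transpose_transpose]
  constructor
  · rw [Matrix.mul_assoc, ← Matrix.mul_assoc _ (toMat h), toMat_transpose_mul, Matrix.one_mul,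
      toMat_mul_transpose]
  · rw [Matrix.mul_assoc, ← Matrix.mul_assoc _ (toMat g), toMat_transpose_mul, Matrix.one_mul,
      toMat_mul_transpose]

theorem measurable_edgeEntry (C : Fin n → Fin K) (R : Fin n → groupOf d κ) (a b : Fin d)
    (e : Fin n × Fin n) : Measurable (edgeEntry C R a b e) := by
  unfold edgeEntry
  split_ifs
  · exact measurable_const
  · exact measurable_toMat_entry a b

theorem abs_edgeEntry_le (C : Fin n → Fin K) (R : Fin n → groupOf d κ) (a b : Fin d)
    (e : Fin n × Fin n) (g : groupOf d κ) : |edgeEntry C R a b e g| ≤ 1 := by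
  unfold edgeEntry
  split_ifs
  · exact abs_orthogonal_entry_le (orthogonal_mul_transpose_mem _ _) a b
  · exact abs_toMat_le g a b

theorem edgeEntry_mean_or_const (C : Fin n → Fin K) (R : Fin n → groupOf d κ) (a b : Fin d)
    (e : Fin n × Fin n) : (∃ c, ∀ g, edgeEntry C R a b e g = c) ∨
      ∫ g, edgeEntry C R a b e g ∂(unif d κ) = 0 := by
  unfold edgeEntry
  split_ifs
  · exact .inl ⟨_, fun _ => rfl⟩
  · exact mean_or_const κ a b

theorem noiseFamily_edgeNoise {p q : ℝ} (hp : p ∈ Set.Icc (0 : ℝ) 1) (hq : q ∈ Set.Icc (0 : ℝ) 1)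
    (C : Fin n → Fin K) (R : Fin n → groupOf d κ) (a b : Fin d) :
    NoiseFamily (sgbmMeasure d κ p q C) (edgeNoise p q C R a b) (max p q) := by
  have hP : ∀ e, (edgeProb p q C e : ℝ) ≤ max p q := by
    intro e
    unfold edgeProb
    split_ifs
    · rw [Set.projIcc_of_mem _ hp]; exact le_max_left _ _
    · rw [Set.projIcc_of_mem _ hq]; exact le_max_right _ _
  have h0 : 0 ≤ max p q := hp.1.trans (le_max_left _ _)
  let X : Fin n × Fin n → Bool × groupOf d κ → ℝ := fun e z =>
    if e.1 < e.2 then centredEdge (unif d κ) (edgeProb p q C e) (edgeEntry C R a b e) z else 0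
  have hX : ∀ e, Measurable (X e) := by
    intro e
    simp only [X]
    split_ifs
    · exact measurable_centredEdge _ (measurable_edgeEntry C R a b e)
    · exact measurable_const
  have hint : ∀ (e : Fin n × Fin n) (F : Bool × groupOf d κ → ℝ), Measurable F →
      ∫ ω, F (ω e) ∂(sgbmMeasure d κ p q C)
        = ∫ z, F z ∂((bernoulliMeasure true false (edgeProb p q C e)).prod (unif d κ)) := by
    intro e F hF
    exact integral_comp_eval (μ := fun e =>
      (bernoulliMeasure true false (edgeProb p q C e)).prod (unif d κ)) hF.aestronglyMeasurable
  refine ⟨?_, fun e => (hX e).comp (measurable_pi_apply e), fun e ω => ?_, fun e => ?_, fun e => ?_⟩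
  · exact iIndepFun_pi (μ := fun e =>
      (bernoulliMeasure true false (edgeProb p q C e)).prod (unif d κ))
      (X := X) fun e => (hX e).aemeasurable
  · unfold edgeNoise
    split_ifs
    · exact abs_centredEdge_le (abs_edgeEntry_le C R a b e) (edgeEntry_mean_or_const C R a b e) _
    · simp
  · refine (hint e (X e) (hX e)).trans ?_
    simp only [X]
    split_ifs
    · exact integral_centredEdge (measurable_edgeEntry C R a b e) (abs_edgeEntry_le C R a b e)
        (edgeEntry_mean_or_const C R a b e)
    · simp
  · refine (hint e (fun z => X e z ^ 2) ((hX e).pow_const 2)).trans_le ?_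
    simp only [X]
    split_ifs
    · exact (integral_centredEdge_sq_le (measurable_edgeEntry C R a b e)
        (abs_edgeEntry_le C R a b e) (edgeEntry_mean_or_const C R a b e)).trans (hP e)
    · simpa using h0

/-- The mean of the observation, up to the diagonal blocks. -/
noncomputable def meanObservation (p q : ℝ) (C : Fin n → Fin K) (R : Fin n → groupOf d κ) :
    Matrix (Fin n × Fin d) (Fin n × Fin d) ℝ :=
  Matrix.of fun x y => if C x.1 = C y.1 then p * (toMat (R x.1) * (toMat (R y.1))ᵀ) x.2 y.2
    else q * meanMat d κ x.2 y.2

/-- The noise families vanish off the strict upper triangle, so at most one of the two noise terms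
is nonzero. The multiple `1 - p` of the identity appears because the diagonal blocks of `A` are the
identity and those of the mean matrix are `p` times it. -/
theorem observation_sub_mean_entry {p q : ℝ} (hp : p ∈ Set.Icc (0 : ℝ) 1)
    (hq : q ∈ Set.Icc (0 : ℝ) 1) (C : Fin n → Fin K) (R : Fin n → groupOf d κ)
    (ω : Fin n × Fin n → Bool × groupOf d κ) (i j : Fin n) (a b : Fin d) :
    (observation C R ω - meanObservation p q C R) (i, a) (j, b)
      = (1 - p) * (if i = j ∧ a = b then 1 else 0)
        + noiseMatrix (edgeNoise p q C R a b) ω i j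
        + noiseMatrix (edgeNoise p q C R b a) ω j i := by
  have hup : ∀ (i j : Fin n) (a b : Fin d), i < j →
      upperBlock C R ω i j a b - (if C i = C j then p * (toMat (R i) * (toMat (R j))ᵀ) a b
        else q * meanMat d κ a b) = noiseMatrix (edgeNoise p q C R a b) ω i j := by
    intro i j a b hij
    have hPc : (edgeProb p q C (i, j) : ℝ) = if C i = C j then p else q := by
      unfold edgeProb
      split_ifs
      · rw [Set.projIcc_of_mem _ hp]
      · rw [Set.projIcc_of_mem _ hq]
    simp only [noiseMatrix, of_apply, edgeNoise, hij, if_true, centredEdge, hPc]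
    unfold upperBlock edgeEntry
    by_cases hC : C i = C j
    · by_cases hb : (ω (i, j)).1 = true <;> simp [hC, hb]
    · by_cases hb : (ω (i, j)).1 = true <;> simp [hC, hb, meanMat]
  have hlow : ∀ (i j : Fin n) (a b : Fin d), ¬ i < j →
      noiseMatrix (edgeNoise p q C R a b) ω i j = 0 := by
    intro i j a b hij
    simp [noiseMatrix, edgeNoise, hij]
  have hMs : ∀ a b, meanMat d κ b a = meanMat d κ a b := fun a b =>
    congrFun (congrFun (meanMat_transpose d κ) a) b
  simp only [observation, meanObservation, Matrix.sub_apply, of_apply]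
  rcases lt_trichotomy i j with hij | hij | hij
  · rw [if_neg hij.ne, if_pos hij, hup i j a b hij, hlow j i b a (not_lt.2 hij.le)]
    simp [hij.ne]
  · subst hij
    rw [hlow i i a b (lt_irrefl _), hlow i i b a (lt_irrefl _), toMat_mul_transpose]
    simp only [if_true, true_and, add_zero, one_apply]
    ring
  · rw [if_neg hij.ne', if_neg (not_lt.2 hij.le), ← hup j i b a hij, hlow i j a b (not_lt.2 hij.le),
      transpose_apply, hMs]
    have e : (toMat (R j) * (toMat (R i))ᵀ) b a = (toMat (R i) * (toMat (R j))ᵀ) a b := by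
      rw [← transpose_apply (toMat (R j) * (toMat (R i))ᵀ), transpose_mul, transpose_transpose]
    rw [e]
    simp only [hij.ne', false_and, if_false, mul_zero, zero_add, eq_comm (a := C j)]

/-- The constants count pieces: 1 for the diagonal, and `d ^ 2` independent-entry matrices for each
of the two triangles. This reduces the symmetric block matrix to matrices with fully independent
entries. -/
theorem bilinBound_observation {p q : ℝ} (hp : p ∈ Set.Icc (0 : ℝ) 1)
    (hq : q ∈ Set.Icc (0 : ℝ) 1) (C : Fin n → Fin K) (R : Fin n → groupOf d κ)
    (ω : Fin n × Fin n → Bool × groupOf d κ) {τ : ℝ} (hτ : 0 ≤ τ)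
    (h : ∀ a b, BilinBound (noiseMatrix (edgeNoise p q C R a b) ω) τ) :
    BilinBound (observation C R ω - meanObservation p q C R) (1 + 2 * d ^ 2 * τ) := by
  intro x y
  set X := √(x ⬝ᵥ x)
  set Y := √(y ⬝ᵥ y)
  have hcol : ∀ (z : Fin n × Fin d → ℝ) (a : Fin d),
      √((fun i => z (i, a)) ⬝ᵥ fun i => z (i, a)) ≤ √(z ⬝ᵥ z) := by
    intro z a
    refine Real.sqrt_le_sqrt ?_
    simp only [dotProduct, Fintype.sum_prod_type]
    exact Finset.sum_le_sum fun i _ =>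
      Finset.single_le_sum (f := fun b => z (i, b) * z (i, b)) (fun b _ => mul_self_nonneg _)
        (Finset.mem_univ a)
  have e : x ⬝ᵥ (observation C R ω - meanObservation p q C R) *ᵥ y
      = (1 - p) * (x ⬝ᵥ y)
        + ∑ a, ∑ b, ((fun i => x (i, a)) ⬝ᵥ noiseMatrix (edgeNoise p q C R a b) ω *ᵥ
            (fun j => y (j, b)))
        + ∑ a, ∑ b, ((fun j => y (j, b)) ⬝ᵥ noiseMatrix (edgeNoise p q C R b a) ω *ᵥ
            (fun i => x (i, a))) := by
    have e1 : x ⬝ᵥ (observation C R ω - meanObservation p q C R) *ᵥ y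
        = ∑ i, ∑ a, ∑ j, ∑ b, x (i, a) * ((1 - p) * (if i = j ∧ a = b then 1 else 0)
          + noiseMatrix (edgeNoise p q C R a b) ω i j
          + noiseMatrix (edgeNoise p q C R b a) ω j i) * y (j, b) := by
      simp only [dotProduct, mulVec, Fintype.sum_prod_type, Finset.mul_sum,
        observation_sub_mean_entry hp hq, mul_assoc]
    rw [e1]
    have hswap : ∀ F : Fin n → Fin d → Fin n → Fin d → ℝ,
        ∑ i, ∑ a, ∑ j, ∑ b, F i a j b = ∑ a, ∑ b, ∑ i, ∑ j, F i a j b := by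
      intro F
      rw [Finset.sum_comm]
      refine Finset.sum_congr rfl fun a _ => ?_
      rw [Finset.sum_comm (s := (Finset.univ : Finset (Fin d)))]
      exact Finset.sum_congr rfl fun i _ => Finset.sum_comm
    simp only [mul_add, add_mul, Finset.sum_add_distrib]
    congr 1
    · congr 1
      · simp only [dotProduct, Fintype.sum_prod_type, Finset.mul_sum]
        refine Finset.sum_congr rfl fun i _ => Finset.sum_congr rfl fun a _ => ?_
        rw [Finset.sum_eq_single i (fun j _ hj => by simp [hj.symm]) (by simp),
          Finset.sum_eq_single a (fun b _ hb => by simp [hb.symm]) (by simp)]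
        simp
        ring
      · rw [hswap]
        simp only [dotProduct, mulVec, Finset.mul_sum, mul_assoc]
    · rw [hswap]
      refine Finset.sum_congr rfl fun a _ => Finset.sum_congr rfl fun b _ => ?_
      rw [Finset.sum_comm]
      simp only [dotProduct, mulVec, Finset.mul_sum]
      exact Finset.sum_congr rfl fun j _ => Finset.sum_congr rfl fun i _ => by ring
  have hXY : 0 ≤ X * Y := mul_nonneg (Real.sqrt_nonneg _) (Real.sqrt_nonneg _)
  have b1 : |(1 - p) * (x ⬝ᵥ y)| ≤ X * Y := by
    rw [abs_mul, abs_of_nonneg (by linarith [hp.2])]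
    have := abs_dotProduct_le x y
    nlinarith [hp.1, abs_nonneg (x ⬝ᵥ y)]
  have hsum : ∀ f : Fin d → Fin d → ℝ, (∀ a b, |f a b| ≤ τ * (X * Y)) →
      |∑ a, ∑ b, f a b| ≤ d ^ 2 * τ * (X * Y) := by
    intro f hf
    calc |∑ a, ∑ b, f a b| ≤ ∑ a, ∑ b, |f a b| :=
          (Finset.abs_sum_le_sum_abs _ _).trans
            (Finset.sum_le_sum fun a _ => Finset.abs_sum_le_sum_abs _ _)
      _ ≤ ∑ _a : Fin d, ∑ _b : Fin d, τ * (X * Y) :=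
          Finset.sum_le_sum fun a _ => Finset.sum_le_sum fun b _ => hf a b
      _ = _ := by simp; ring
  have b2 := hsum _ fun a b => (h a b (fun i => x (i, a)) (fun j => y (j, b))).trans
    (mul_le_mul_of_nonneg_left (mul_le_mul (hcol x a) (hcol y b) (Real.sqrt_nonneg _)
      (Real.sqrt_nonneg _)) hτ)
  have b3 := hsum _ fun a b => (h b a (fun j => y (j, b)) (fun i => x (i, a))).trans
    ((mul_le_mul_of_nonneg_left (mul_le_mul (hcol y b) (hcol x a) (Real.sqrt_nonneg _)
      (Real.sqrt_nonneg _)) hτ).trans_eq (by rw [mul_comm Y X]))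
  rw [e]
  refine (abs_add_three _ _ _).trans ?_
  linarith

end Model
end GPM

namespace GPM
open Matrix MeasureTheory ProbabilityTheory

/-! ### The Frobenius inner product -/

section FrobeniusInner

variable {α β γ : Type*} [Fintype α] [Fintype β] [Fintype γ]

/-- The Frobenius inner product. -/
noncomputable def frobInner (X Y : Matrix α β ℝ) : ℝ := (Xᵀ * Y).trace

theorem frobInner_eq_sum (X Y : Matrix α β ℝ) : frobInner X Y = ∑ i, ∑ j, X i j * Y i j := by
  simp only [frobInner, trace, diag_apply, mul_apply, transpose_apply]
  exact Finset.sum_comm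

theorem frobInner_comm (X Y : Matrix α β ℝ) : frobInner X Y = frobInner Y X := by
  simp only [frobInner_eq_sum, mul_comm]

theorem frobInner_add_right (X Y Z : Matrix α β ℝ) :
    frobInner X (Y + Z) = frobInner X Y + frobInner X Z := by
  simp [frobInner, Matrix.mul_add]

theorem frobInner_sub_right (X Y Z : Matrix α β ℝ) :
    frobInner X (Y - Z) = frobInner X Y - frobInner X Z := by
  simp [frobInner, Matrix.mul_sub]

theorem frobInner_sub_left (X Y Z : Matrix α β ℝ) :
    frobInner (X - Y) Z = frobInner X Z - frobInner Y Z := by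
  simp [frobInner, Matrix.sub_mul]

theorem frobInner_smul_right (c : ℝ) (X Y : Matrix α β ℝ) :
    frobInner X (c • Y) = c * frobInner X Y := by
  simp [frobInner]

theorem frobInner_neg_left (X Y : Matrix α β ℝ) : frobInner (-X) Y = -frobInner X Y := by
  simp [frobInner]

theorem frobInner_sum_right {ι : Type*} (s : Finset ι) (X : Matrix α β ℝ) (Y : ι → Matrix α β ℝ) :
    frobInner X (∑ i ∈ s, Y i) = ∑ i ∈ s, frobInner X (Y i) := by
  simp [frobInner, Matrix.mul_sum, trace_sum]

theorem frobInner_self_nonneg (X : Matrix α β ℝ) : 0 ≤ frobInner X X := by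
  rw [frobInner_eq_sum]
  exact Finset.sum_nonneg fun i _ => Finset.sum_nonneg fun j _ => mul_self_nonneg _

theorem frobInner_transpose (X Y : Matrix α β ℝ) : frobInner Xᵀ Yᵀ = frobInner X Y := by
  rw [frobInner, frobInner, transpose_transpose, ← trace_transpose, transpose_mul,
    transpose_transpose, trace_mul_comm]

theorem frobInner_mul_left (X : Matrix α β ℝ) (Y : Matrix α γ ℝ) (Z : Matrix γ β ℝ) :
    frobInner X (Y * Z) = frobInner (Yᵀ * X) Z := by
  rw [frobInner, frobInner, transpose_mul, transpose_transpose, Matrix.mul_assoc]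

theorem frobInner_mul_right (X : Matrix α β ℝ) (Y : Matrix α γ ℝ) (Z : Matrix γ β ℝ) :
    frobInner X (Y * Z) = frobInner (X * Zᵀ) Y := by
  rw [frobInner, frobInner, transpose_mul, transpose_transpose, ← Matrix.mul_assoc,
    trace_mul_comm, ← Matrix.mul_assoc]

theorem frobInner_sub_self (X Y : Matrix α β ℝ) :
    frobInner (X - Y) (X - Y) = frobInner X X + frobInner Y Y - 2 * frobInner X Y := by
  rw [frobInner_sub_left, frobInner_sub_right, frobInner_sub_right, frobInner_comm Y X]
  ring

theorem frobNorm_eq_sqrt (X : Matrix α β ℝ) : frobNorm X = √(frobInner X X) := by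
  rw [frobNorm, frobenius_norm_def, Real.sqrt_eq_rpow, frobInner_eq_sum]
  simp [sq]

theorem frobNorm_sq (X : Matrix α β ℝ) : frobNorm X ^ 2 = frobInner X X := by
  rw [frobNorm_eq_sqrt, Real.sq_sqrt (frobInner_self_nonneg X)]

theorem frobNorm_nonneg (X : Matrix α β ℝ) : 0 ≤ frobNorm X := by
  rw [frobNorm_eq_sqrt]; exact Real.sqrt_nonneg _

theorem frobInner_mul_self_le (X : Matrix α β ℝ) (Y : Matrix β γ ℝ) :
    frobInner (X * Y) (X * Y) ≤ frobInner X X * frobInner Y Y := by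
  have h : frobNorm (X * Y) ≤ frobNorm X * frobNorm Y := frobenius_norm_mul X Y
  rw [← frobNorm_sq, ← frobNorm_sq, ← frobNorm_sq, ← mul_pow]
  exact pow_le_pow_left₀ (frobNorm_nonneg _) h 2

theorem frobInner_self_eq_sum_columns (Z : Matrix α β ℝ) :
    frobInner Z Z = ∑ c, (fun i => Z i c) ⬝ᵥ (fun i => Z i c) := by
  rw [frobInner_eq_sum, Finset.sum_comm]
  rfl

theorem BilinBound.frobInner_le {N : Matrix α β ℝ} {τ : ℝ} (hτ : 0 ≤ τ) (h : BilinBound N τ)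
    (X : Matrix α γ ℝ) (Y : Matrix β γ ℝ) :
    |frobInner X (N * Y)| ≤ τ * (frobNorm X * frobNorm Y) := by
  have e : frobInner X (N * Y) = ∑ c, (fun i => X i c) ⬝ᵥ N *ᵥ (fun j => Y j c) := by
    rw [frobInner_eq_sum, Finset.sum_comm]
    rfl
  rw [e]
  calc _ ≤ ∑ c, τ * (√((fun i => X i c) ⬝ᵥ (fun i => X i c))
        * √((fun j => Y j c) ⬝ᵥ (fun j => Y j c))) :=
        (Finset.abs_sum_le_sum_abs _ _).trans (Finset.sum_le_sum fun c _ => h _ _)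
    _ = τ * ∑ c, √((fun i => X i c) ⬝ᵥ (fun i => X i c))
        * √((fun j => Y j c) ⬝ᵥ (fun j => Y j c)) := by rw [Finset.mul_sum]
    _ ≤ _ := by
        refine mul_le_mul_of_nonneg_left ?_ hτ
        refine (Real.sum_mul_le_sqrt_mul_sqrt _ _ _).trans_eq ?_
        rw [frobNorm_eq_sqrt, frobNorm_eq_sqrt, frobInner_self_eq_sum_columns X,
          frobInner_self_eq_sum_columns Y]
        simp only [Real.sq_sqrt (dotProduct_self_nonneg _)]

end FrobeniusInner

/-! ### Orthogonal matrices and the Procrustes optimality condition -/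

section Orthogonal

variable {d : ℕ}

theorem frobInner_one_left (X : Matrix (Fin d) (Fin d) ℝ) : frobInner 1 X = X.trace := by
  simp [frobInner]

theorem frobInner_orthogonal_self {U : Matrix (Fin d) (Fin d) ℝ} (hU : U ∈ OGroup d) :
    frobInner U U = d := by
  rw [frobInner, ((mem_OGroup_iff U).1 hU).2, trace_one, Fintype.card_fin]

theorem frobInner_orthogonal_le {U V : Matrix (Fin d) (Fin d) ℝ} (hU : U ∈ OGroup d)
    (hV : V ∈ OGroup d) : frobInner U V ≤ d := by
  have h := frobInner_self_nonneg (U - V)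
  rw [frobInner_sub_self, frobInner_orthogonal_self hU, frobInner_orthogonal_self hV] at h
  linarith

theorem mul_mem_OGroup {U V : Matrix (Fin d) (Fin d) ℝ} (hU : U ∈ OGroup d) (hV : V ∈ OGroup d) :
    U * V ∈ OGroup d := (OGroup d).mul_mem hU hV

theorem transpose_mem_OGroup {U : Matrix (Fin d) (Fin d) ℝ} (hU : U ∈ OGroup d) :
    Uᵀ ∈ OGroup d := by
  rw [mem_OGroup_iff] at hU ⊢
  rw [transpose_transpose]
  exact hU.symm

theorem toMat_mem {κ : GroupKind} (g : groupOf d κ) : toMat g ∈ OGroup d := (g : OGroup d).2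

open scoped Matrix.Norms.Operator in
/-- First-order optimality of the orthogonal Procrustes problem at the identity. -/
theorem symm_of_trace_max {T : Matrix (Fin d) (Fin d) ℝ}
    (h : ∀ U ∈ OGroup d, frobInner U T ≤ T.trace) : Tᵀ = T := by
  -- The skew part of `T` is the test direction: `exp (s B)` is a curve of orthogonal matrices
  -- through 1, and the vanishing derivative there gives `⟨T, B⟩ = 0`, whence `⟨B, B⟩ = 0`.
  set B : Matrix (Fin d) (Fin d) ℝ := T - Tᵀ with hB
  have hBt : Bᵀ = -B := by simp [hB]
  have hmem : ∀ s : ℝ, NormedSpace.exp (s • B) ∈ OGroup d := by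
    intro s
    have e : (NormedSpace.exp (s • B))ᵀ = NormedSpace.exp (-(s • B)) := by
      rw [← exp_transpose, transpose_smul, hBt, smul_neg]
    rw [mem_OGroup_iff, e]
    constructor
    · rw [← Matrix.exp_add_of_commute _ _ (Commute.neg_right (Commute.refl (s • B))), add_neg_cancel,
        NormedSpace.exp_zero]
    · rw [← Matrix.exp_add_of_commute _ _ (Commute.neg_left (Commute.refl (s • B))), neg_add_cancel,
        NormedSpace.exp_zero]
  let L : Matrix (Fin d) (Fin d) ℝ →ₗ[ℝ] ℝ :=
    { toFun := fun U => frobInner T U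
      map_add' := fun U V => frobInner_add_right _ _ _
      map_smul' := fun c U => frobInner_smul_right _ _ _ }
  have hder : HasDerivAt (fun s : ℝ => L (NormedSpace.exp (s • B))) (L B) 0 := by
    have h1 := hasDerivAt_exp_smul_const (𝕂 := ℝ) B 0
    rw [zero_smul, NormedSpace.exp_zero, Matrix.one_mul] at h1
    exact (LinearMap.toContinuousLinearMap L).hasFDerivAt.comp_hasDerivAt 0 h1
  have hmax : IsLocalMax (fun s : ℝ => L (NormedSpace.exp (s • B))) 0 := by
    refine Filter.Eventually.of_forall fun s => ?_
    have h1 : L (NormedSpace.exp ((0 : ℝ) • B)) = T.trace := by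
      change frobInner T _ = _
      rw [zero_smul, NormedSpace.exp_zero, frobInner_comm, frobInner_one_left]
    simp only [h1]
    change frobInner T _ ≤ _
    rw [frobInner_comm]
    exact h _ (hmem s)
  have h0 : frobInner T B = 0 := hmax.hasDerivAt_eq_zero hder
  have h1 : frobInner Tᵀ B = - frobInner T B := by
    rw [← frobInner_transpose, transpose_transpose, hBt, frobInner_comm, frobInner_neg_left,
      frobInner_comm]
  have h2 : frobInner B B = 0 := by
    rw [hB, frobInner_sub_left, ← hB, h1, h0]; simp
  have h3 : B = 0 := by
    rw [frobInner, ← conjTranspose_eq_transpose_of_trivial] at h2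
    exact trace_conjTranspose_mul_self_eq_zero_iff.1 h2
  exact (sub_eq_zero.1 h3).symm

end Orthogonal
end GPM

namespace GPM
open Matrix

/-! ### The nuclear norm and its duality with orthogonal matrices -/

section Nuclear

variable {d : ℕ}

/-- In an orthonormal eigenbasis `e` of `XᵀX` the inner product is the sum of `⟨U e k, X e k⟩`, and
`‖X e k‖` is the `k`-th singular value while `U` preserves norms. -/
theorem frobInner_le_nuclearNorm {U : Matrix (Fin d) (Fin d) ℝ} (hU : U ∈ OGroup d)
    (X : Matrix (Fin d) (Fin d) ℝ) : frobInner U X ≤ nuclearNorm X := by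
  set T := Matrix.toEuclideanLin X
  set S := Matrix.toEuclideanLin U
  have hd : Module.finrank ℝ (EuclideanSpace ℝ (Fin d)) = d := by simp
  set e := T.isSymmetric_adjoint_comp_self.eigenvectorBasis hd
  have hT : ∀ k, ‖T (e k)‖ = T.singularValues k := by
    intro k
    rw [LinearMap.singularValues_fin T hd k, ← Real.sqrt_sq (norm_nonneg (T (e k)))]
    congr 1
    have h1 := T.isSymmetric_adjoint_comp_self.apply_eigenvectorBasis hd k
    rw [← real_inner_self_eq_norm_sq, ← LinearMap.adjoint_inner_left]
    change inner ℝ ((LinearMap.adjoint T ∘ₗ T) (e k)) (e k) = _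
    rw [h1]
    simp [inner_smul_left, e]
  have hS : ∀ v, ‖S v‖ = ‖v‖ := by
    intro v
    rw [EuclideanSpace.norm_eq, EuclideanSpace.norm_eq]
    congr 1
    have : (U *ᵥ v.ofLp) ⬝ᵥ (U *ᵥ v.ofLp) = v.ofLp ⬝ᵥ v.ofLp := by
      rw [dotProduct_mulVec, ← mulVec_transpose, mulVec_mulVec, ((mem_OGroup_iff U).1 hU).2,
        one_mulVec]
    simpa [dotProduct, sq, S, Matrix.toLpLin_apply] using this
  have htr : frobInner U X = ∑ k, inner ℝ (S (e k)) (T (e k)) := by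
    have h1 : frobInner U X = LinearMap.trace ℝ _ (LinearMap.adjoint S ∘ₗ T) := by
      rw [LinearMap.trace_eq_sum_inner _ (EuclideanSpace.basisFun (Fin d) ℝ), frobInner_eq_sum,
        Finset.sum_comm]
      refine Finset.sum_congr rfl fun i _ => ?_
      rw [LinearMap.comp_apply, LinearMap.adjoint_inner_right]
      simp [S, T, Matrix.toLpLin_apply, PiLp.inner_apply, mul_comm]
    rw [h1, LinearMap.trace_eq_sum_inner _ e]
    refine Finset.sum_congr rfl fun k _ => ?_
    rw [LinearMap.comp_apply, LinearMap.adjoint_inner_right]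
  rw [htr, nuclearNorm, Finset.sum_range]
  refine Finset.sum_le_sum fun k _ => ?_
  refine (real_inner_le_norm _ _).trans_eq ?_
  rw [hS, hT, e.orthonormal.1 k, one_mul]

theorem nuclearNorm_nonneg (X : Matrix (Fin d) (Fin d) ℝ) : 0 ≤ nuclearNorm X :=
  Finset.sum_nonneg fun k _ => LinearMap.singularValues_nonneg _ k

theorem nuclearNorm_smul_orthogonal_le {U : Matrix (Fin d) (Fin d) ℝ} (hU : U ∈ OGroup d) {c : ℝ}
    (hc : 0 ≤ c) : nuclearNorm (c • U) ≤ d * c := by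
  set T := Matrix.toEuclideanLin (c • U)
  have hd : Module.finrank ℝ (EuclideanSpace ℝ (Fin d)) = d := by simp
  set e := T.isSymmetric_adjoint_comp_self.eigenvectorBasis hd
  have hS : ∀ v, ‖T v‖ ^ 2 = c ^ 2 * ‖v‖ ^ 2 := by
    intro v
    have : ((c • U) *ᵥ v.ofLp) ⬝ᵥ ((c • U) *ᵥ v.ofLp) = c ^ 2 * (v.ofLp ⬝ᵥ v.ofLp) := by
      rw [smul_mulVec, smul_dotProduct, dotProduct_smul, dotProduct_mulVec, ← mulVec_transpose,
        mulVec_mulVec, ((mem_OGroup_iff U).1 hU).2, one_mulVec]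
      simp only [smul_eq_mul]; ring
    rw [EuclideanSpace.norm_sq_eq, EuclideanSpace.norm_sq_eq]
    simp only [T, Matrix.toLpLin_apply, Real.norm_eq_abs, sq_abs]
    simpa only [dotProduct, ← sq] using this
  have hT : ∀ k : Fin d, T.singularValues k = c := by
    intro k
    have h1 := T.isSymmetric_adjoint_comp_self.apply_eigenvectorBasis hd k
    have h2 : T.isSymmetric_adjoint_comp_self.eigenvalues hd k = c ^ 2 := by
      have h3 : ‖T (e k)‖ ^ 2 = T.isSymmetric_adjoint_comp_self.eigenvalues hd k := by
        rw [← real_inner_self_eq_norm_sq, ← LinearMap.adjoint_inner_left]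
        change inner ℝ ((LinearMap.adjoint T ∘ₗ T) (e k)) (e k) = _
        rw [h1]
        simp [inner_smul_left, e]
      rw [← h3, hS, e.orthonormal.1 k]; ring
    rw [LinearMap.singularValues_fin T hd k, h2, Real.sqrt_sq hc]
  rw [nuclearNorm, Finset.sum_range]
  simp [T] at hT ⊢
  simp [hT]

end Nuclear
end GPM

namespace GPM
open Matrix

/-! ### Block calculus for assembled matrices -/

section Blocks

variable {n K d : ℕ} {κ : GroupKind}

/-- The `(i, j)` block of size `d × d` of a square matrix. -/
def sqBlock (A : Matrix (Fin n × Fin d) (Fin n × Fin d) ℝ) (i j : Fin n) :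
    Matrix (Fin d) (Fin d) ℝ :=
  Matrix.of fun a b => A (i, a) (j, b)

theorem block_mul (A : Matrix (Fin n × Fin d) (Fin n × Fin d) ℝ)
    (X : Matrix (Fin n × Fin d) (Fin K × Fin d) ℝ) (i : Fin n) (k : Fin K) :
    block (A * X) i k = ∑ j, sqBlock A i j * block X j k := by
  ext a b
  simp only [block, sqBlock, of_apply, mul_apply, Matrix.sum_apply, Fintype.sum_prod_type]

theorem block_add (X Y : Matrix (Fin n × Fin d) (Fin K × Fin d) ℝ) (i : Fin n) (k : Fin K) :
    block (X + Y) i k = block X i k + block Y i k := rfl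

theorem block_sub (X Y : Matrix (Fin n × Fin d) (Fin K × Fin d) ℝ) (i : Fin n) (k : Fin K) :
    block (X - Y) i k = block X i k - block Y i k := rfl

theorem block_assemble (C : Fin n → Fin K) (R : Fin n → groupOf d κ) (i : Fin n) (k : Fin K) :
    block (assemble C R) i k = if C i = k then toMat (R i) else 0 := by
  ext a b
  simp only [block, assemble, of_apply]
  split_ifs <;> rfl

theorem frobInner_eq_sum_blocks (X Y : Matrix (Fin n × Fin d) (Fin K × Fin d) ℝ) :
    frobInner X Y = ∑ i, ∑ k, frobInner (block X i k) (block Y i k) := by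
  simp only [frobInner_eq_sum, block, of_apply, Fintype.sum_prod_type]
  exact Finset.sum_congr rfl fun i _ => Finset.sum_comm

theorem frobInner_zero_left {α β : Type*} [Fintype α] [Fintype β] (Y : Matrix α β ℝ) :
    frobInner 0 Y = 0 := by simp [frobInner]

theorem frobInner_zero_right {α β : Type*} [Fintype α] [Fintype β] (X : Matrix α β ℝ) :
    frobInner X 0 = 0 := by simp [frobInner]

theorem frobInner_assemble (C : Fin n → Fin K) (R : Fin n → groupOf d κ)
    (X : Matrix (Fin n × Fin d) (Fin K × Fin d) ℝ) :
    frobInner (assemble C R) X = ∑ i, frobInner (toMat (R i)) (block X i (C i)) := by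
  rw [frobInner_eq_sum_blocks]
  refine Finset.sum_congr rfl fun i _ => ?_
  rw [Finset.sum_eq_single (C i)]
  · rw [block_assemble, if_pos rfl]
  · intro k _ hk
    rw [block_assemble, if_neg hk.symm, frobInner_zero_left]
  · simp

theorem frobInner_assemble_self (C : Fin n → Fin K) (R : Fin n → groupOf d κ) :
    frobInner (assemble C R) (assemble C R) = n * d := by
  rw [frobInner_assemble]
  simp [block_assemble, frobInner_orthogonal_self (toMat_mem _)]

/-- The squared distance of the rows `i` of two assembled matrices. -/
noncomputable def rowDist (C c : Fin n → Fin K) (R O : Fin n → groupOf d .orthogonal)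
    (i : Fin n) : ℝ :=
  if c i = C i then frobInner (toMat (R i) - toMat (O i)) (toMat (R i) - toMat (O i)) else 2 * d

theorem rowDist_nonneg (C c : Fin n → Fin K) (R O : Fin n → groupOf d .orthogonal) (i : Fin n) :
    0 ≤ rowDist C c R O i := by
  unfold rowDist
  split_ifs
  · exact frobInner_self_nonneg _
  · positivity

theorem rowDist_eq (C c : Fin n → Fin K) (R O : Fin n → groupOf d .orthogonal) (i : Fin n) :
    rowDist C c R O i = 2 * (d - if c i = C i then frobInner (toMat (R i)) (toMat (O i)) else 0) := by
  unfold rowDist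
  split_ifs
  · rw [frobInner_sub_self, frobInner_orthogonal_self (toMat_mem _),
      frobInner_orthogonal_self (toMat_mem _)]; ring
  · ring

theorem frobInner_assemble_sub (C c : Fin n → Fin K) (R O : Fin n → groupOf d .orthogonal) :
    frobInner (assemble C R - assemble c O) (assemble C R - assemble c O)
      = ∑ i, rowDist C c R O i := by
  rw [frobInner_sub_self, frobInner_assemble_self, frobInner_assemble_self, frobInner_assemble]
  simp only [rowDist_eq, block_assemble]
  rw [← Finset.mul_sum, Finset.sum_sub_distrib]
  have : ∀ i, frobInner (toMat (R i)) (if c i = C i then toMat (O i) else 0)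
      = if c i = C i then frobInner (toMat (R i)) (toMat (O i)) else 0 := by
    intro i
    split_ifs
    · rfl
    · rw [frobInner_zero_right]
  simp only [this]
  simp
  ring

end Blocks

/-! ### The contraction step -/

section Contraction

variable {n K d : ℕ}

/-- One step of the projected power iteration contracts, provided the mean part of the update
does not destroy the separation. -/
theorem norm_sub_le_of_separation (hd : 1 ≤ d) (C c c' : Fin n → Fin K)
    (R O O' : Fin n → groupOf d .orthogonal)
    (A M : Matrix (Fin n × Fin d) (Fin n × Fin d) ℝ) {τ s : ℝ} (hτ : 0 ≤ τ) (hs : 0 < s)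
    (hN : BilinBound (A - M) τ) (g : Fin n → ℝ)
    (hg : ∀ i, s ≤ d * g i)
    (hdiag : ∀ i, block (A * assemble C R) i (C i) = g i • toMat (R i))
    (hsep : ∀ i l, l ≠ C i → ∀ U ∈ OGroup d,
      s ≤ d * g i - frobInner U (block (A * assemble C R) i l))
    (hopt : frobInner (assemble C R) (A * assemble c O)
      ≤ frobInner (assemble c' O') (A * assemble c O))
    (hY1 : ∀ i l, l ≠ C i → ∀ U ∈ OGroup d,
      -(s / 2) ≤ frobInner (toMat (R i)) (block (M * (assemble c O - assemble C R)) i (C i))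
        - frobInner U (block (M * (assemble c O - assemble C R)) i l))
    (hY2 : ∀ i, ∀ U ∈ OGroup d, -(g i / 4) * frobInner (toMat (R i) - U) (toMat (R i) - U)
      ≤ frobInner (toMat (R i) - U) (block (M * (assemble c O - assemble C R)) i (C i))) :
    s / (4 * d) * frobNorm (assemble C R - assemble c' O')
      ≤ τ * frobNorm (assemble c O - assemble C R) := by
  have hd0 : (0 : ℝ) < d := by exact_mod_cast hd
  set V' := assemble C R
  set D := assemble c O - V' with hD
  set X1 := A * V' + M * D with hX1
  have hX : A * assemble c O = X1 + (A - M) * D := by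
    rw [hX1, hD, Matrix.mul_sub, Matrix.mul_sub, Matrix.sub_mul, Matrix.sub_mul]
    abel
  -- A misplaced row has distance `2d`, so the claim there is a gain of `s/2`: the margin `s` less
  -- the loss `s/2`. For a row in its own cluster, `g i • R i` gives the gain `g i / 2` times the
  -- squared distance, of which half is lost.
  have hrow : ∀ i, s / (4 * d) * rowDist C c' R O' i
      ≤ frobInner (toMat (R i)) (block X1 i (C i))
        - frobInner (toMat (O' i)) (block X1 i (c' i)) := by
    intro i
    rw [hX1, block_add, block_add, frobInner_add_right, frobInner_add_right, hdiag,
      frobInner_smul_right, frobInner_orthogonal_self (toMat_mem _)]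
    unfold rowDist
    split_ifs with hc
    · rw [hc, hdiag, frobInner_smul_right]
      have h2 := hY2 i _ (toMat_mem (O' i))
      set F := frobInner (toMat (R i) - toMat (O' i)) (toMat (R i) - toMat (O' i)) with hF
      have hF0 : 0 ≤ F := frobInner_self_nonneg _
      have h3 : F = 2 * (d - frobInner (toMat (O' i)) (toMat (R i))) := by
        rw [hF, frobInner_sub_self, frobInner_orthogonal_self (toMat_mem _),
          frobInner_orthogonal_self (toMat_mem _), frobInner_comm (toMat (R i))]; ring
      rw [frobInner_sub_left] at h2
      have h4 : s / (4 * d) ≤ g i / 4 := by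
        rw [div_le_iff₀ (by positivity)]
        have := hg i
        linarith
      have h5 : s / (4 * d) * F ≤ g i / 4 * F := mul_le_mul_of_nonneg_right h4 hF0
      have h6 : g i * d - g i * frobInner (toMat (O' i)) (toMat (R i)) = g i / 2 * F := by
        rw [h3]; ring
      linarith
    · have h1 := hsep i (c' i) hc _ (toMat_mem (O' i))
      have h2 := hY1 i (c' i) hc _ (toMat_mem (O' i))
      have h3 : s / (4 * d) * (2 * d) = s / 2 := by field_simp; ring
      rw [h3]
      linarith
  have hsum : s / (4 * d) * frobInner (V' - assemble c' O') (V' - assemble c' O')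
      ≤ frobInner (V' - assemble c' O') X1 := by
    rw [frobInner_assemble_sub, Finset.mul_sum, frobInner_sub_left, frobInner_assemble,
      frobInner_assemble, ← Finset.sum_sub_distrib]
    exact Finset.sum_le_sum fun i _ => hrow i
  have h1 : frobInner (V' - assemble c' O') X1
      ≤ τ * (frobNorm (V' - assemble c' O') * frobNorm D) := by
    have h2 := (abs_le.1 (hN.frobInner_le hτ (V' - assemble c' O') D)).1
    -- The optimality of the projection; only the noise term can now compensate the gain from `X1`.
    have h3 : frobInner (V' - assemble c' O') (X1 + (A - M) * D) ≤ 0 := by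
      rw [← hX, frobInner_sub_left]
      linarith
    rw [frobInner_add_right] at h3
    linarith
  rw [← frobNorm_sq] at hsum
  have h0 := frobNorm_nonneg (V' - assemble c' O')
  rcases eq_or_lt_of_le h0 with hz | hpos
  · rw [← hz, mul_zero]
    exact mul_nonneg hτ (frobNorm_nonneg _)
  · refine le_of_mul_le_mul_left ?_ hpos
    nlinarith

end Contraction

/-! ### The mean part when the cross-cluster mean vanishes -/

section MeanZero

variable {n K d : ℕ}

/-- The mean part of the update preserves the separation between own and foreign blocks. -/
theorem frobInner_diff_rows (C c : Fin n → Fin K) (R O : Fin n → groupOf d .orthogonal)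
    {p P : ℝ} (hp : 0 ≤ p) (M : Matrix (Fin n × Fin d) (Fin n × Fin d) ℝ)
    (hM : ∀ i j, sqBlock M i j = if C i = C j then p • (toMat (R i) * (toMat (R j))ᵀ) else 0)
    (hP : p * frobInner (assemble C R - assemble c O) (assemble C R - assemble c O) ≤ P)
    (i : Fin n) (l : Fin K) (hl : l ≠ C i) (U : Matrix (Fin d) (Fin d) ℝ) (hU : U ∈ OGroup d) :
    -P ≤ frobInner (toMat (R i)) (block (M * (assemble c O - assemble C R)) i (C i))
        - frobInner U (block (M * (assemble c O - assemble C R)) i l) := by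
  rw [block_mul, block_mul, frobInner_sum_right, frobInner_sum_right, ← Finset.sum_sub_distrib]
  refine (neg_le_neg hP).trans ?_
  rw [frobInner_assemble_sub, Finset.mul_sum, ← Finset.sum_neg_distrib]
  refine Finset.sum_le_sum fun j _ => ?_
  have hr := mul_nonneg hp (rowDist_nonneg C c R O j)
  rw [hM]
  split_ifs with hC
  · rw [block_sub, block_sub, block_assemble, block_assemble, block_assemble, block_assemble,
      if_pos (hC.symm : C j = C i),
      if_neg (fun h : C j = l => hl (h.symm.trans hC.symm)), smul_mul_assoc, smul_mul_assoc,
      frobInner_smul_right, frobInner_smul_right, ← mul_sub, ← mul_neg]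
    refine mul_le_mul_of_nonneg_left ?_ hp
    have e1 : frobInner (toMat (R i)) (toMat (R i) * (toMat (R j))ᵀ
        * ((if c j = C i then toMat (O j) else 0) - toMat (R j)))
        = (if c j = C j then frobInner (toMat (R j)) (toMat (O j)) else 0) - d := by
      rw [Matrix.mul_assoc, frobInner_mul_left, toMat_transpose_mul, Matrix.mul_sub,
        frobInner_sub_right, toMat_transpose_mul, frobInner_one_left, frobInner_one_left, trace_one,
        Fintype.card_fin, hC]
      split_ifs
      · rfl
      · simp
    rw [e1, sub_zero, rowDist_eq]
    -- A correctly placed `j` costs half its row distance and does not touch the foreign block. A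
    -- misplaced `j` costs `d` in the own block and at most `d` in the foreign one, together its row
    -- distance `2d`.
    by_cases h1 : c j = C j
    · rw [if_pos h1, if_neg (fun h => hl (h.symm.trans (h1.trans hC.symm))), Matrix.mul_zero,
        frobInner_zero_right]
      have := frobInner_orthogonal_le (toMat_mem (R j)) (toMat_mem (O j))
      linarith
    · rw [if_neg h1]
      have hd0 : (0 : ℝ) ≤ d := Nat.cast_nonneg d
      split_ifs
      · have := frobInner_orthogonal_le hU (mul_mem_OGroup (mul_mem_OGroup (toMat_mem (R i))
          (transpose_mem_OGroup (toMat_mem (R j)))) (toMat_mem (O j)))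
        linarith
      · rw [Matrix.mul_zero, frobInner_zero_right]
        linarith
  · rw [Matrix.zero_mul, Matrix.zero_mul, frobInner_zero_right, frobInner_zero_right]
    linarith

/-- Orthogonality of `Z` gives `EᵀE = E + Eᵀ`, and a symmetric `S` pairs equally with `E` and `Eᵀ`.
So an expression linear in `E` turns out to be quadratic. -/
theorem frobInner_one_sub_eq {E Z S : Matrix (Fin d) (Fin d) ℝ} (hZ : Z ∈ OGroup d)
    (hE : E = 1 - Z) (hS : Sᵀ = S) : frobInner E S = frobInner E (E * S) / 2 := by
  have h1 : frobInner Eᵀ S = frobInner E S := by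
    rw [← frobInner_transpose, transpose_transpose, hS]
  have h2 : Eᵀ * E = E + Eᵀ := by
    rw [hE, transpose_sub, transpose_one, Matrix.sub_mul, Matrix.mul_sub, Matrix.mul_sub,
      ((mem_OGroup_iff Z).1 hZ).2]
    simp only [Matrix.one_mul, Matrix.mul_one]
    abel
  have h3 : frobInner E (E * S) = frobInner E S + frobInner Eᵀ S := by
    rw [frobInner_mul_left, h2, frobInner, transpose_add, Matrix.add_mul, trace_add]
    rfl
  rw [h3, h1]; ring

/-- The same identity with the roles exchanged, now `1 - Z` against the symmetric matrix `EᵀE`,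
makes the bound quadratic in `1 - Z` as well. -/
theorem frobInner_conj_one_sub_le (E : Matrix (Fin d) (Fin d) ℝ) {Z : Matrix (Fin d) (Fin d) ℝ}
    (hZ : Z ∈ OGroup d) :
    frobInner E (E * (1 - Z)) ≤ frobInner E E * frobInner (1 - Z) (1 - Z) / 2 := by
  have hsym : (Eᵀ * E)ᵀ = Eᵀ * E := by simp
  have h1 : frobInner E (E * (1 - Z)) = frobInner (1 - Z) (Eᵀ * E) := by
    rw [frobInner_mul_left, frobInner_comm]
  have h2 := frobInner_one_sub_eq hZ rfl hsym
  have h3 : frobInner (1 - Z) ((1 - Z) * (Eᵀ * E)) = frobInner ((1 - Z) * Eᵀ) ((1 - Z) * Eᵀ) := by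
    rw [← Matrix.mul_assoc, frobInner_mul_right]
  have h4 := frobInner_mul_self_le (1 - Z) Eᵀ
  rw [frobInner_transpose] at h4
  rw [h1, h2, h3]
  linarith

/-- The mean part of the update preserves the optimality of the own rotation. -/
theorem frobInner_diff_rotation (hd : 1 ≤ d) (C c : Fin n → Fin K)
    (R O : Fin n → groupOf d .orthogonal)
    {p P : ℝ} (hp : 0 ≤ p) (M : Matrix (Fin n × Fin d) (Fin n × Fin d) ℝ)
    (hM : ∀ i j, sqBlock M i j = if C i = C j then p • (toMat (R i) * (toMat (R j))ᵀ) else 0)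
    (hsym : ∀ k, (∑ j with C j = k ∧ c j = k, (toMat (R j))ᵀ * toMat (O j))ᵀ
      = ∑ j with C j = k ∧ c j = k, (toMat (R j))ᵀ * toMat (O j))
    (hP : p * frobInner (assemble C R - assemble c O) (assemble C R - assemble c O) ≤ P)
    (i : Fin n) (U : Matrix (Fin d) (Fin d) ℝ) (hU : U ∈ OGroup d) :
    -(P / 2) * frobInner (toMat (R i) - U) (toMat (R i) - U)
      ≤ frobInner (toMat (R i) - U) (block (M * (assemble c O - assemble C R)) i (C i)) := by
  set B : Fin n → Matrix (Fin d) (Fin d) ℝ := fun j =>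
    1 - if c j = C i then (toMat (R j))ᵀ * toMat (O j) else 0 with hB
  set S := ∑ j with C j = C i, B j with hS
  set E := 1 - (toMat (R i))ᵀ * U with hE
  have hZ : (toMat (R i))ᵀ * U ∈ OGroup d :=
    mul_mem_OGroup (transpose_mem_OGroup (toMat_mem _)) hU
  have hRE : toMat (R i) - U = toMat (R i) * E := by
    rw [hE, Matrix.mul_sub, ← Matrix.mul_assoc, toMat_mul_transpose, Matrix.mul_one, Matrix.one_mul]
  have hblock : block (M * (assemble c O - assemble C R)) i (C i)
      = -(p • (toMat (R i) * S)) := by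
    rw [block_mul, hS, Matrix.mul_sum, Finset.smul_sum, Finset.sum_filter, ← Finset.sum_neg_distrib]
    refine Finset.sum_congr rfl fun j _ => ?_
    rw [hM]
    by_cases h : C j = C i
    · rw [if_pos h.symm, if_pos h, block_sub, block_assemble, block_assemble, if_pos h,
        smul_mul_assoc, ← smul_neg, Matrix.mul_assoc, Matrix.mul_sub, toMat_transpose_mul, hB]
      congr 1
      simp only [← Matrix.mul_neg, neg_sub]
      split_ifs
      · rfl
      · simp
    · rw [if_neg (fun h' => h h'.symm), if_neg h]; simp
  -- The optimal alignment enters here: without symmetry of `S` the pairing with `E` would be of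
  -- first order, and small rotations could not be controlled.
  have hSsym : Sᵀ = S := by
    have e : S = ∑ j with C j = C i, (1 : Matrix (Fin d) (Fin d) ℝ)
        - ∑ j with C j = C i ∧ c j = C i, (toMat (R j))ᵀ * toMat (O j) := by
      rw [hS, hB, Finset.sum_sub_distrib, ← Finset.filter_filter, Finset.sum_filter (p := fun j => c j = C i)]
    rw [e, transpose_sub, hsym, transpose_sum]
    simp
  have h1 : frobInner (toMat (R i) - U) (block (M * (assemble c O - assemble C R)) i (C i))
      = -(p * (frobInner E (E * S) / 2)) := by
    rw [hblock, hRE, ← smul_neg, frobInner_smul_right, ← Matrix.mul_neg, frobInner_mul_left,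
      ← Matrix.mul_assoc, toMat_transpose_mul, Matrix.one_mul, frobInner_comm, frobInner_neg_left,
      frobInner_comm, frobInner_one_sub_eq hZ hE hSsym]
    ring
  have h2 : frobInner (toMat (R i) - U) (toMat (R i) - U) = frobInner E E := by
    rw [hRE, frobInner_mul_left, ← Matrix.mul_assoc, toMat_transpose_mul, Matrix.one_mul]
  have hEE : 0 ≤ frobInner E E := frobInner_self_nonneg E
  have h3 : frobInner E (E * S) ≤ frobInner E E *
      frobInner (assemble C R - assemble c O) (assemble C R - assemble c O) := by
    rw [hS, Matrix.mul_sum, frobInner_sum_right, frobInner_assemble_sub, Finset.mul_sum,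
      Finset.sum_filter]
    refine Finset.sum_le_sum fun j _ => ?_
    have hr := mul_nonneg hEE (rowDist_nonneg C c R O j)
    split_ifs with h
    · simp only [hB]
      by_cases hc : c j = C i
      · rw [if_pos hc]
        have h4 := frobInner_conj_one_sub_le E
          (mul_mem_OGroup (transpose_mem_OGroup (toMat_mem (R j))) (toMat_mem (O j)))
        have h5 : frobInner (1 - (toMat (R j))ᵀ * toMat (O j)) (1 - (toMat (R j))ᵀ * toMat (O j))
            = rowDist C c R O j := by
          have hm := mul_mem_OGroup (transpose_mem_OGroup (toMat_mem (R j))) (toMat_mem (O j))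
          rw [rowDist_eq, if_pos (hc.trans h.symm), frobInner_sub_self,
            frobInner_orthogonal_self hm, frobInner_orthogonal_self (OGroup d).one_mem,
            frobInner_one_left, frobInner]
          ring
        rw [h5] at h4
        linarith
      · rw [if_neg hc, sub_zero, Matrix.mul_one]
        have h6 : rowDist C c R O j = 2 * d := by
          unfold rowDist
          rw [if_neg (fun h' => hc (h'.trans h))]
        rw [h6]
        have : (1 : ℝ) ≤ d := by exact_mod_cast hd
        nlinarith
    · exact hr
  rw [h1, h2]
  have h7 := mul_le_mul_of_nonneg_left h3 hp
  have h8 := mul_le_mul_of_nonneg_right hP hEE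
  nlinarith

end MeanZero

/-! ### The mean part in dimension one -/

section Scalar

variable {n K : ℕ}

theorem toMat_scalar_eq {κ : GroupKind} (g : groupOf 1 κ) : toMat g 0 0 = 1 ∨ toMat g 0 0 = -1 := by
  have h := congrFun (congrFun (toMat_mul_transpose g) 0) 0
  rw [mul_apply] at h
  simp at h
  exact mul_self_eq_one_iff.1 h

/-- The entries of the difference of two assembled sign matrices are integers, and `|x| ≤ x²` for
integers. Quadratic smallness thus needs no structure of `M` beyond bounded entries. -/
theorem abs_block_le_scalar (C c : Fin n → Fin K) (R O : Fin n → groupOf 1 .orthogonal)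
    {P : ℝ} (M : Matrix (Fin n × Fin 1) (Fin n × Fin 1) ℝ)
    (hM : ∀ x y, |M x y| ≤ P) (i : Fin n) (l : Fin K) :
    |block (M * (assemble c O - assemble C R)) i l 0 0|
      ≤ P * ∑ j, ((assemble c O - assemble C R) (j, 0) (l, 0)) ^ 2 := by
  have hent : ∀ j, |(assemble c O - assemble C R) (j, 0) (l, 0)|
      ≤ ((assemble c O - assemble C R) (j, 0) (l, 0)) ^ 2 := by
    intro j
    simp only [Matrix.sub_apply, assemble, of_apply]
    rcases toMat_scalar_eq (O j) with h1 | h1 <;> rcases toMat_scalar_eq (R j) with h2 | h2 <;>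
      rw [h1, h2] <;> split_ifs <;> norm_num
  simp only [block, of_apply, mul_apply, Fintype.sum_prod_type]
  rw [Finset.mul_sum]
  refine (Finset.abs_sum_le_sum_abs _ _).trans (Finset.sum_le_sum fun j _ => ?_)
  rw [Fin.sum_univ_one, abs_mul]
  exact mul_le_mul (hM _ _) (hent j) (abs_nonneg _) ((abs_nonneg _).trans (hM (i, 0) (j, 0)))

theorem sum_abs_block_le_scalar (C c : Fin n → Fin K) (R O : Fin n → groupOf 1 .orthogonal)
    {P Q : ℝ} (M : Matrix (Fin n × Fin 1) (Fin n × Fin 1) ℝ)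
    (hM : ∀ x y, |M x y| ≤ P)
    (hQ : P * frobInner (assemble C R - assemble c O) (assemble C R - assemble c O) ≤ Q)
    (i : Fin n) : ∑ l, |block (M * (assemble c O - assemble C R)) i l 0 0| ≤ Q := by
  refine (Finset.sum_le_sum fun l _ => abs_block_le_scalar C c R O M hM i l).trans ?_
  refine le_trans (le_of_eq ?_) hQ
  rw [← Finset.mul_sum, Finset.sum_comm, frobInner_eq_sum]
  simp only [Fintype.sum_prod_type, Fin.sum_univ_one]
  congr 1
  refine Finset.sum_congr rfl fun j _ => Finset.sum_congr rfl fun l _ => ?_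
  simp only [Matrix.sub_apply]
  ring

theorem frobInner_scalar (X Y : Matrix (Fin 1) (Fin 1) ℝ) : frobInner X Y = X 0 0 * Y 0 0 := by
  simp [frobInner_eq_sum]

theorem orthogonal_scalar {U : Matrix (Fin 1) (Fin 1) ℝ} (hU : U ∈ OGroup 1) :
    U 0 0 = 1 ∨ U 0 0 = -1 :=
  toMat_scalar_eq (κ := .orthogonal) ⟨⟨U, hU⟩, Subgroup.mem_top _⟩

theorem frobInner_diff_rows_scalar (C c : Fin n → Fin K) (R O : Fin n → groupOf 1 .orthogonal)
    {P Q : ℝ} (M : Matrix (Fin n × Fin 1) (Fin n × Fin 1) ℝ)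
    (hM : ∀ x y, |M x y| ≤ P)
    (hQ : P * frobInner (assemble C R - assemble c O) (assemble C R - assemble c O) ≤ Q)
    (i : Fin n) (l : Fin K) (hl : l ≠ C i) (U : Matrix (Fin 1) (Fin 1) ℝ) (hU : U ∈ OGroup 1) :
    -Q ≤ frobInner (toMat (R i)) (block (M * (assemble c O - assemble C R)) i (C i))
        - frobInner U (block (M * (assemble c O - assemble C R)) i l) := by
  have h := sum_abs_block_le_scalar C c R O M hM hQ i
  have h2 := Finset.sum_le_sum_of_subset_of_nonneg (Finset.subset_univ {l, C i})
    (f := fun l => |block (M * (assemble c O - assemble C R)) i l 0 0|)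
    (fun k _ _ => abs_nonneg _)
  rw [Finset.sum_pair hl] at h2
  rw [frobInner_scalar, frobInner_scalar]
  have b1 := abs_le.1 (le_refl |block (M * (assemble c O - assemble C R)) i l 0 0|)
  have b2 := abs_le.1 (le_refl |block (M * (assemble c O - assemble C R)) i (C i) 0 0|)
  rcases toMat_scalar_eq (R i) with h3 | h3 <;> rcases orthogonal_scalar hU with h4 | h4 <;>
    rw [h3, h4] <;> linarith [b1.1, b1.2, b2.1, b2.2]

theorem frobInner_diff_rotation_scalar (C c : Fin n → Fin K)
    (R O : Fin n → groupOf 1 .orthogonal)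
    {P Q : ℝ} (M : Matrix (Fin n × Fin 1) (Fin n × Fin 1) ℝ)
    (hM : ∀ x y, |M x y| ≤ P)
    (hQ : P * frobInner (assemble C R - assemble c O) (assemble C R - assemble c O) ≤ Q)
    (i : Fin n) (U : Matrix (Fin 1) (Fin 1) ℝ) (hU : U ∈ OGroup 1) :
    -(Q / 2) * frobInner (toMat (R i) - U) (toMat (R i) - U)
      ≤ frobInner (toMat (R i) - U) (block (M * (assemble c O - assemble C R)) i (C i)) := by
  have h := sum_abs_block_le_scalar C c R O M hM hQ i
  have h2 := (Finset.single_le_sum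
    (f := fun l => |block (M * (assemble c O - assemble C R)) i l 0 0|)
    (fun k _ => abs_nonneg _) (Finset.mem_univ (C i))).trans h
  have b2 := abs_le.1 h2
  rw [frobInner_scalar, frobInner_scalar, Matrix.sub_apply]
  rcases toMat_scalar_eq (R i) with h3 | h3 <;> rcases orthogonal_scalar hU with h4 | h4 <;>
    rw [h3, h4] <;> norm_num <;> linarith [b2.1, b2.2]

end Scalar
end GPM

namespace GPM
open Matrix MeasureTheory

/-! ### Symmetries of the ground truth and optimal alignment -/

section Symmetries

variable {n K d : ℕ} {κ : GroupKind}

/-- An element of the group, as an element of the orthogonal group. -/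
def toOrth (g : groupOf d κ) : groupOf d .orthogonal := ⟨g.1, Subgroup.mem_top _⟩

/-- The clustering function of a transformed ground truth. -/
def moveCluster (σ : Equiv.Perm (Fin K)) (C : Fin n → Fin K) (i : Fin n) : Fin K := σ (C i)

/-- The group elements of a transformed ground truth. -/
def moveGroup (U : Fin K → groupOf d .orthogonal) (C : Fin n → Fin K) (R : Fin n → groupOf d κ)
    (i : Fin n) : groupOf d .orthogonal := toOrth (R i) * U (C i)

theorem toMat_moveGroup (U : Fin K → groupOf d .orthogonal) (C : Fin n → Fin K)
    (R : Fin n → groupOf d κ) (i : Fin n) :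
    toMat (moveGroup U C R i) = toMat (R i) * toMat (U (C i)) := rfl

/-- The matrix of a symmetry. -/
noncomputable def symMat (σ : Equiv.Perm (Fin K)) (U : Fin K → groupOf d .orthogonal) :
    Matrix (Fin K × Fin d) (Fin K × Fin d) ℝ :=
  bdiag U * Matrix.kroneckerMap (fun x y => x * y) (σ.permMatrix ℝ)
    (1 : Matrix (Fin d) (Fin d) ℝ)

theorem symMat_apply (σ : Equiv.Perm (Fin K)) (U : Fin K → groupOf d .orthogonal)
    (x y : Fin K × Fin d) :
    symMat σ U x y = if σ x.1 = y.1 then toMat (U x.1) x.2 y.2 else 0 := by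
  obtain ⟨k, a⟩ := x
  obtain ⟨l, b⟩ := y
  simp only [symMat, mul_apply, bdiag, of_apply, kroneckerMap_apply, Fintype.sum_prod_type,
    Equiv.Perm.permMatrix, PEquiv.toMatrix_apply, Equiv.toPEquiv_apply, one_apply]
  rw [Finset.sum_eq_single k (fun k' _ hk' => by simp [hk'.symm]) (by simp),
    Finset.sum_eq_single b (fun b' _ hb' => by simp [hb']) (by simp)]
  simp [eq_comm]

theorem assemble_mul_symMat (C : Fin n → Fin K) (R : Fin n → groupOf d κ)
    (σ : Equiv.Perm (Fin K)) (U : Fin K → groupOf d .orthogonal) :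
    assemble C R * symMat σ U = assemble (moveCluster σ C) (moveGroup U C R) := by
  ext ⟨i, a⟩ ⟨l, b⟩
  simp only [mul_apply, symMat_apply, assemble, of_apply, Fintype.sum_prod_type, toMat_moveGroup,
    moveCluster]
  rw [Finset.sum_eq_single (C i) (fun k _ hk => by simp [hk.symm]) (by simp)]
  simp only [if_true]
  split_ifs <;> simp

theorem estError_le (C : Fin n → Fin K) (R : Fin n → groupOf d κ)
    (V : Matrix (Fin n × Fin d) (Fin K × Fin d) ℝ)
    (σ : Equiv.Perm (Fin K)) (U : Fin K → groupOf d .orthogonal) :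
    estError .orthogonal (assemble C R) V
      ≤ frobNorm (V - assemble (moveCluster σ C) (moveGroup U C R)) := by
  rw [← assemble_mul_symMat]
  exact ciInf_le (f := fun Q : symGroup K d .orthogonal =>
    frobNorm (V - assemble C R * (Q : Matrix (Fin K × Fin d) (Fin K × Fin d) ℝ)))
    ⟨0, by rintro _ ⟨Q, rfl⟩; exact frobNorm_nonneg _⟩ ⟨symMat σ U, U, σ, rfl⟩

/-- There are finitely many permutations, and for each the rotations range over a compact group. -/
theorem exists_estError_eq (C : Fin n → Fin K) (R : Fin n → groupOf d κ)
    (V : Matrix (Fin n × Fin d) (Fin K × Fin d) ℝ) :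
    ∃ (σ : Equiv.Perm (Fin K)) (U : Fin K → groupOf d .orthogonal),
      estError .orthogonal (assemble C R) V
        = frobNorm (V - assemble (moveCluster σ C) (moveGroup U C R)) := by
  have hcont : ∀ σ : Equiv.Perm (Fin K), Continuous fun U : Fin K → groupOf d .orthogonal =>
      frobNorm (V - assemble C R * symMat σ U) := by
    intro σ
    have h1 : Continuous fun U : Fin K → groupOf d .orthogonal => symMat σ U := by
      refine continuous_matrix fun x y => ?_
      simp only [symMat_apply]
      split_ifs
      · exact (continuous_toMat.comp (continuous_apply x.1)).matrix_elem _ _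
      · exact continuous_const
    have h2 : Continuous fun U : Fin K → groupOf d .orthogonal =>
        V - assemble C R * symMat σ U :=
      continuous_const.sub (continuous_const.matrix_mul h1)
    simp only [frobNorm_eq_sqrt]
    exact Real.continuous_sqrt.comp (h2.matrix_transpose.matrix_mul h2).matrix_trace
  have hmin : ∀ σ : Equiv.Perm (Fin K), ∃ U : Fin K → groupOf d .orthogonal, ∀ U',
      frobNorm (V - assemble C R * symMat σ U) ≤ frobNorm (V - assemble C R * symMat σ U') := by
    intro σ
    obtain ⟨U, -, hU⟩ := isCompact_univ.exists_isMinOn Set.univ_nonempty (hcont σ).continuousOn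
    exact ⟨U, fun U' => hU (Set.mem_univ U')⟩
  choose U hU using hmin
  obtain ⟨σ, hσ⟩ := Finite.exists_min fun σ => frobNorm (V - assemble C R * symMat σ (U σ))
  refine ⟨σ, U σ, le_antisymm (estError_le C R V σ (U σ)) ?_⟩
  rw [← assemble_mul_symMat]
  have : Nonempty (symGroup K d .orthogonal) := ⟨⟨symMat σ (U σ), U σ, σ, rfl⟩⟩
  refine le_ciInf ?_
  rintro ⟨_, U', σ', rfl⟩
  exact (hσ σ').trans (hU σ' U')

/-- At the optimal symmetry, the cross-covariances of the aligned clusters are symmetric. -/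
theorem crossCov_symm (C : Fin n → Fin K) (R : Fin n → groupOf d κ) (c : Fin n → Fin K)
    (O : Fin n → groupOf d .orthogonal) {σ : Equiv.Perm (Fin K)}
    {U : Fin K → groupOf d .orthogonal}
    (h : estError .orthogonal (assemble C R) (assemble c O)
        = frobNorm (assemble c O - assemble (moveCluster σ C) (moveGroup U C R))) (k : Fin K) :
    (∑ j with moveCluster σ C j = k ∧ c j = k, (toMat (moveGroup U C R j))ᵀ * toMat (O j))ᵀ
      = ∑ j with moveCluster σ C j = k ∧ c j = k, (toMat (moveGroup U C R j))ᵀ * toMat (O j) := by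
  refine symm_of_trace_max fun G hG => ?_
  set g : groupOf d .orthogonal := ⟨⟨G, hG⟩, Subgroup.mem_top _⟩
  -- Turning only the cluster that is sent to `k` changes only the terms of that cluster in the
  -- error, which isolates a Procrustes problem maximized at the identity.
  set U' := Function.update U (σ.symm k) (U (σ.symm k) * g) with hU'
  have h1 := estError_le C R (assemble c O) σ U'
  rw [h] at h1
  have h2 := pow_le_pow_left₀ (frobNorm_nonneg _) h1 2
  rw [frobNorm_sq, frobNorm_sq, frobInner_assemble_sub, frobInner_assemble_sub] at h2
  simp only [rowDist_eq, ← Finset.mul_sum, Finset.sum_sub_distrib] at h2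
  have h3 : ∑ i, (if moveCluster σ C i = c i then
        frobInner (toMat (O i)) (toMat (moveGroup U' C R i)) else 0)
      ≤ ∑ i, (if moveCluster σ C i = c i then
        frobInner (toMat (O i)) (toMat (moveGroup U C R i)) else 0) := by linarith
  have key : ∀ i, (if moveCluster σ C i = k ∧ c i = k then
        frobInner G ((toMat (moveGroup U C R i))ᵀ * toMat (O i)) else 0)
      - (if moveCluster σ C i = k ∧ c i = k then
        ((toMat (moveGroup U C R i))ᵀ * toMat (O i)).trace else 0)
      = (if moveCluster σ C i = c i then
        frobInner (toMat (O i)) (toMat (moveGroup U' C R i)) else 0)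
      - (if moveCluster σ C i = c i then
        frobInner (toMat (O i)) (toMat (moveGroup U C R i)) else 0) := by
    intro i
    by_cases hk : moveCluster σ C i = k
    · have hCi : C i = σ.symm k := by rw [← hk]; simp [moveCluster]
      have e : toMat (moveGroup U' C R i) = toMat (moveGroup U C R i) * G := by
        rw [toMat_moveGroup, toMat_moveGroup, hU', hCi, Function.update_self, toMat_mul,
          ← Matrix.mul_assoc]
        rfl
      by_cases hc : c i = k
      · rw [if_pos ⟨hk, hc⟩, if_pos ⟨hk, hc⟩, if_pos (hk.trans hc.symm), if_pos (hk.trans hc.symm), e,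
          frobInner_mul_left (toMat (O i)), frobInner_comm G, frobInner_comm (toMat (O i))]
        congr 1
      · rw [if_neg (fun h => hc h.2), if_neg (fun h => hc h.2),
          if_neg (fun h => hc (h.symm.trans hk)), if_neg (fun h => hc (h.symm.trans hk))]
    · have hCi : C i ≠ σ.symm k := fun h' => hk (by simp [moveCluster, h'])
      have e : toMat (moveGroup U' C R i) = toMat (moveGroup U C R i) := by
        rw [toMat_moveGroup, toMat_moveGroup, hU', Function.update_of_ne hCi]
      rw [e, if_neg (fun h => hk h.1), if_neg (fun h => hk h.1)]
      ring
  rw [frobInner_sum_right, trace_sum, Finset.sum_filter, Finset.sum_filter]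
  have := Finset.sum_congr rfl fun i (_ : i ∈ Finset.univ) => key i
  rw [Finset.sum_sub_distrib, Finset.sum_sub_distrib] at this
  linarith

theorem balanced_moveCluster {m : ℕ} {C : Fin n → Fin K} (h : Balanced m C)
    (σ : Equiv.Perm (Fin K)) : Balanced m (moveCluster σ C) := by
  intro k
  rw [← h (σ.symm k)]
  congr 1
  refine Finset.filter_congr fun i _ => ?_
  simp only [moveCluster, Equiv.eq_symm_apply]

theorem block_mul_symMat (X : Matrix (Fin n × Fin d) (Fin K × Fin d) ℝ)
    (σ : Equiv.Perm (Fin K)) (U : Fin K → groupOf d .orthogonal) (i : Fin n) (k : Fin K) :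
    block (X * symMat σ U) i (σ k) = block X i k * toMat (U k) := by
  ext a b
  simp only [block, of_apply, mul_apply, Fintype.sum_prod_type, symMat_apply]
  rw [Finset.sum_eq_single k (fun k' _ hk' => by simp [hk']) (by simp)]
  simp

end Symmetries

/-! ### Consequences of separation for the observed degrees -/

section Observation

variable {n K d : ℕ} {κ : GroupKind}

/-- The number of neighbours of `i` in its own cluster, counting `i` itself. -/
noncomputable def ownDegree (C : Fin n → Fin K) (ω : Fin n × Fin n → Bool × groupOf d κ)
    (i : Fin n) : ℝ :=
  ∑ j, if C j = C i ∧ (i = j ∨ (i < j ∧ (ω (i, j)).1 = true) ∨ (j < i ∧ (ω (j, i)).1 = true))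
    then 1 else 0

theorem ownDegree_nonneg (C : Fin n → Fin K) (ω : Fin n × Fin n → Bool × groupOf d κ)
    (i : Fin n) : 0 ≤ ownDegree C ω i :=
  Finset.sum_nonneg fun j _ => by split_ifs <;> norm_num

theorem sqBlock_observation (C : Fin n → Fin K) (R : Fin n → groupOf d κ)
    (ω : Fin n × Fin n → Bool × groupOf d κ) (i j : Fin n) :
    sqBlock (observation C R ω) i j = if i = j then 1 else if i < j then upperBlock C R ω i j
      else (upperBlock C R ω j i)ᵀ := by
  ext a b
  simp only [sqBlock, observation, of_apply]

theorem block_observation_own (C : Fin n → Fin K) (R : Fin n → groupOf d κ)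
    (ω : Fin n × Fin n → Bool × groupOf d κ) (i : Fin n) :
    block (observation C R ω * assemble C R) i (C i) = ownDegree C ω i • toMat (R i) := by
  rw [block_mul, ownDegree, Finset.sum_smul]
  refine Finset.sum_congr rfl fun j _ => ?_
  rw [block_assemble, sqBlock_observation]
  by_cases hC : C j = C i
  · rw [if_pos hC]
    rcases lt_trichotomy i j with hij | hij | hij
    · rw [if_neg hij.ne, if_pos hij, upperBlock, if_pos hC.symm]
      by_cases hb : (ω (i, j)).1 = true
      · rw [if_pos hb, Matrix.mul_assoc, toMat_transpose_mul]
        simp [hC, hij, hb]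
      · simp [hij.ne, hij.not_gt, hb]
    · subst hij
      simp
    · rw [if_neg hij.ne', if_neg hij.not_gt, upperBlock, if_pos hC]
      by_cases hb : (ω (j, i)).1 = true
      · rw [if_pos hb, transpose_mul, transpose_transpose, Matrix.mul_assoc, toMat_transpose_mul]
        simp [hC, hij, hb]
      · simp [hij.ne', hij.not_gt, hb]
  · simp [hC]

theorem sqBlock_meanObservation (p q : ℝ) (C : Fin n → Fin K) (R : Fin n → groupOf d κ)
    (i j : Fin n) : sqBlock (meanObservation p q C R) i j
      = if C i = C j then p • (toMat (R i) * (toMat (R j))ᵀ) else q • meanMat d κ := by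
  ext a b
  simp only [sqBlock, meanObservation, of_apply]
  split_ifs <;> simp

theorem frobInner_meanObservation {m : ℕ} {C : Fin n → Fin K} (hC : Balanced m C)
    (R : Fin n → groupOf d κ) (p q : ℝ) :
    frobInner (assemble C R) (meanObservation p q C R * assemble C R) = n * (m * p * d) := by
  rw [frobInner_assemble]
  have : ∀ i, frobInner (toMat (R i)) (block (meanObservation p q C R * assemble C R) i (C i))
      = m * p * d := by
    intro i
    rw [block_mul, frobInner_sum_right]
    have e : ∀ j, frobInner (toMat (R i)) (sqBlock (meanObservation p q C R) i j
        * block (assemble C R) j (C i)) = if C j = C i then p * d else 0 := by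
      intro j
      rw [sqBlock_meanObservation, block_assemble]
      by_cases h : C j = C i
      · rw [if_pos h, if_pos h.symm, if_pos h, smul_mul_assoc, Matrix.mul_assoc,
          toMat_transpose_mul, Matrix.mul_one, frobInner_smul_right,
          frobInner_orthogonal_self (toMat_mem _)]
      · rw [if_neg h, if_neg h, Matrix.mul_zero, frobInner_zero_right]
    rw [Finset.sum_congr rfl fun j _ => e j, ← Finset.sum_filter, Finset.sum_const, hC (C i),
      nsmul_eq_mul, mul_assoc]
  rw [Finset.sum_congr rfl fun i _ => this i]
  simp

/-- The separation level cannot exceed the average degree by much. -/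
theorem separation_le {m : ℕ} {C : Fin n → Fin K} (hC : Balanced m C) (hn : 0 < n)
    (R : Fin n → groupOf d κ) (ω : Fin n × Fin n → Bool × groupOf d κ) {p q τ s : ℝ}
    (hτ : 0 ≤ τ) (hN : BilinBound (observation C R ω - meanObservation p q C R) τ)
    (hg : ∀ i, s ≤ d * ownDegree C ω i) : s ≤ (m * p + τ) * d := by
  -- Testing `A` against the ground truth yields the total own-cluster degree, so the noise bound
  -- pins its average near `m p`.
  have h1 : frobInner (assemble C R) (observation C R ω * assemble C R)
      = ∑ i, d * ownDegree C ω i := by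
    rw [frobInner_assemble]
    refine Finset.sum_congr rfl fun i _ => ?_
    rw [block_observation_own, frobInner_smul_right, frobInner_orthogonal_self (toMat_mem _),
      mul_comm]
  have h2 : n * s ≤ ∑ i, d * ownDegree C ω i := by
    calc n * s = ∑ _i : Fin n, s := by simp
      _ ≤ _ := Finset.sum_le_sum fun i _ => hg i
  have h3 := (abs_le.1 (hN.frobInner_le hτ (assemble C R) (assemble C R))).2
  rw [Matrix.sub_mul, frobInner_sub_right, h1, frobInner_meanObservation hC, ← sq, frobNorm_sq,
    frobInner_assemble_self] at h3
  have hn0 : (0 : ℝ) < n := by exact_mod_cast hn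
  refine le_of_mul_le_mul_left (?_ : n * s ≤ n * ((m * p + τ) * d)) hn0
  linarith

/-- In the case without rotations, separation forces the probability across clusters to be not
much larger than the probability inside. -/
theorem cross_prob_le {m : ℕ} {C : Fin n → Fin K} (hK : 2 ≤ K) (hC : Balanced m C) (hm : 0 < m)
    (R : Fin n → groupOf 1 .specialOrthogonal)
    (ω : Fin n × Fin n → Bool × groupOf 1 .specialOrthogonal) {p q τ s : ℝ}
    (hs : 0 < s) (hN : BilinBound (observation C R ω - meanObservation p q C R) τ)
    (hsep : ∀ i l, l ≠ C i → ∀ U ∈ OGroup 1,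
      s ≤ (1 : ℕ) * ownDegree C ω i - frobInner U (block (observation C R ω * assemble C R) i l)) :
    q * m ≤ p * m + 2 * τ := by
  set A := observation C R ω
  set M := meanObservation p q C R
  let ind : Fin K → Fin n × Fin 1 → ℝ := fun k z => if C z.1 = k then 1 else 0
  have hquad : ∀ (N : Matrix (Fin n × Fin 1) (Fin n × Fin 1) ℝ) (k l : Fin K),
      ind k ⬝ᵥ N *ᵥ ind l = ∑ i with C i = k, ∑ j with C j = l, N (i, 0) (j, 0) := by
    intro N k l
    simp [ind, dotProduct, mulVec, Fintype.sum_prod_type, Finset.sum_filter]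
  have hblock : ∀ i l, block (A * assemble C R) i l 0 0 = ∑ j with C j = l, A (i, 0) (j, 0) := by
    intro i l
    simp [block, mul_apply, Fintype.sum_prod_type, assemble, Finset.sum_filter, toMat_eq_one]
  have hM : ∀ k l, ind k ⬝ᵥ M *ᵥ ind l = m * m * (if k = l then p else q) := by
    intro k l
    have e : ∀ i ∈ Finset.univ.filter (fun i => C i = k),
        ∑ j with C j = l, M (i, 0) (j, 0) = m * (if k = l then p else q) := by
      intro i hi
      have hi' : C i = k := (Finset.mem_filter.1 hi).2
      have e2 : ∀ j ∈ Finset.univ.filter (fun j => C j = l),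
          M (i, 0) (j, 0) = if k = l then p else q := by
        intro j hj
        have hj' : C j = l := (Finset.mem_filter.1 hj).2
        simp [M, meanObservation, hi', hj', toMat_eq_one, meanMat_eq_one]
      rw [Finset.sum_congr rfl e2, Finset.sum_const, hC l, nsmul_eq_mul]
    rw [hquad, Finset.sum_congr rfl e, Finset.sum_const, hC k, nsmul_eq_mul, mul_assoc]
  have hnorm : ∀ k, √(ind k ⬝ᵥ ind k) * √(ind k ⬝ᵥ ind k) = m := by
    intro k
    rw [Real.mul_self_sqrt (dotProduct_self_nonneg _)]
    have e : ∀ i, (if C i = k then (1 : ℝ) else 0) * (if C i = k then 1 else 0)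
        = if C i = k then 1 else 0 := fun i => by split_ifs <;> norm_num
    simp only [ind, dotProduct, Fintype.sum_prod_type, Fin.sum_univ_one, e]
    rw [Finset.sum_boole, hC k]
  have hsq : ∀ k l, √(ind k ⬝ᵥ ind k) * √(ind l ⬝ᵥ ind l) = m := by
    intro k l
    have h1 : ∀ k, √(ind k ⬝ᵥ ind k) = √m := fun k => by
      rw [← hnorm k, Real.sqrt_mul_self (Real.sqrt_nonneg _)]
    rw [h1, h1, Real.mul_self_sqrt (Nat.cast_nonneg m)]
  let k : Fin K := ⟨0, by omega⟩
  let l : Fin K := ⟨1, by omega⟩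
  have hkl : l ≠ k := by simp [k, l, Fin.ext_iff]
  have b1 := (abs_le.1 (hN (ind k) (ind k))).2
  have b2 := (abs_le.1 (hN (ind k) (ind l))).1
  rw [sub_mulVec, dotProduct_sub, hM, hsq, if_pos rfl] at b1
  rw [sub_mulVec, dotProduct_sub, hM, hsq, if_neg hkl.symm] at b2
  -- Separation says that each vertex of cluster `k` has at least as many neighbours in `k` as in
  -- `l`; summing over `k` compares two block sums of `A`, with means `m² q` and `m² p` up to noise.
  have b3 : ind k ⬝ᵥ A *ᵥ ind l ≤ ind k ⬝ᵥ A *ᵥ ind k := by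
    rw [hquad, hquad]
    refine Finset.sum_le_sum fun i hi => ?_
    have hi' : C i = k := (Finset.mem_filter.1 hi).2
    have h1 := hsep i l (by rw [hi']; exact hkl) 1 (OGroup 1).one_mem
    have h2 := congrFun (congrFun (block_observation_own C R ω i) 0) 0
    rw [hblock, hi', toMat_eq_one] at h2
    rw [frobInner_scalar, hblock] at h1
    simp at h1 h2
    linarith
  have hm0 : (0 : ℝ) < m := by exact_mod_cast hm
  refine le_of_mul_le_mul_left (?_ : m * (q * m) ≤ m * (p * m + 2 * τ)) hm0
  linarith

end Observation
end GPM

namespace GPM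
open Matrix MeasureTheory

/-! ### The error halves; probability of the noise event -/

section Step

variable {n K d : ℕ} {κ : GroupKind}

theorem frobNorm_sub_comm {α β : Type*} [Fintype α] [Fintype β] (X Y : Matrix α β ℝ) :
    frobNorm (X - Y) = frobNorm (Y - X) := by
  rw [frobNorm_eq_sqrt, frobNorm_eq_sqrt, frobInner_sub_self, frobInner_sub_self,
    frobInner_comm X Y, add_comm (frobInner X X)]

/-- All assembled matrices have squared norm `n d`, so minimizing the distance to `X` is maximizing
the inner product with `X`. -/
theorem frobInner_le_of_isProj {m : ℕ} {X : Matrix (Fin n × Fin d) (Fin K × Fin d) ℝ}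
    {C c : Fin n → Fin K} {R O : Fin n → groupOf d .orthogonal} (hC : Balanced m C)
    (h : IsProj m X (assemble c O)) : frobInner (assemble C R) X ≤ frobInner (assemble c O) X := by
  have h1 := pow_le_pow_left₀ (frobNorm_nonneg _) (h.2 _ ⟨C, R, hC, rfl⟩) 2
  rw [frobNorm_sq, frobNorm_sq, frobInner_sub_self, frobInner_sub_self, frobInner_assemble_self,
    frobInner_assemble_self] at h1
  linarith

/-- One step of the generalized power method halves the error, on the event that the noise is
small compared to the separation. -/
theorem estError_step {m : ℕ} (hK : 2 ≤ K) (hd : 1 ≤ d) (hn : 0 < n) (hm : 0 < m)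
    {p q : ℝ} (hp : 0 < p) (hq : 0 ≤ q) {C : Fin n → Fin K} (hC : Balanced m C)
    (R : Fin n → groupOf d κ) (ω : Fin n × Fin n → Bool × groupOf d κ)
    {τ : ℝ} (hτ : 0 ≤ τ) (hN : BilinBound (observation C R ω - meanObservation p q C R) τ)
    {χ : ℝ} (hχ : 0 < χ) (hτ1 : 2 * τ ≤ m * p) (hτ2 : 8 * d * τ ≤ χ * m * p)
    (hsep : PreservesBySeparation (observation C R ω) C (assemble C R) (χ * m * p))
    {V W : Matrix (Fin n × Fin d) (Fin K × Fin d) ℝ} (hV : V ∈ relaxed n K d m)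
    (hW : IsProj m (observation C R ω * V) W)
    (hinit : 8 * d ^ 2 * estError .orthogonal (assemble C R) V ^ 2 ≤ m * χ ^ 2) :
    estError .orthogonal (assemble C R) W ≤ 1 / 2 * estError .orthogonal (assemble C R) V := by
  obtain ⟨c, O, -, rfl⟩ := hV
  obtain ⟨c', O', -, rfl⟩ := hW.1
  set A := observation C R ω with hA
  set s := χ * m * p with hs
  have hs0 : 0 < s := hsep.1
  have hd1 : (1 : ℝ) ≤ d := by exact_mod_cast hd
  have hd0 : (0 : ℝ) < d := by linarith
  have hm0 : (0 : ℝ) < m := by exact_mod_cast hm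
  set g := ownDegree C ω with hgdef
  have hown : ∀ i, blockNuclear (A * assemble C R) i (C i) ≤ d * g i := by
    intro i
    rw [blockNuclear, of_apply, block_observation_own]
    exact nuclearNorm_smul_orthogonal_le (toMat_mem _) (ownDegree_nonneg C ω i)
  have hg : ∀ i, s ≤ d * g i := by
    intro i
    have : Nontrivial (Fin K) := Fin.nontrivial_iff_two_le.2 hK
    obtain ⟨l, hl⟩ := exists_ne (C i)
    have h1 := hsep.2 i l hl
    have h2 : 0 ≤ blockNuclear (A * assemble C R) i l := nuclearNorm_nonneg _
    linarith [hown i]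
  have hsepU : ∀ i l, l ≠ C i → ∀ U ∈ OGroup d,
      s ≤ d * g i - frobInner U (block (A * assemble C R) i l) := by
    intro i l hl U hU
    have h1 := hsep.2 i l hl
    have h2 : frobInner U (block (A * assemble C R) i l) ≤ blockNuclear (A * assemble C R) i l :=
      frobInner_le_nuclearNorm hU _
    linarith [hown i]
  -- The average degree caps `χ`. This turns the initial bound, of order `χ²`, into a budget linear
  -- in `s`.
  have hχd : χ ≤ 2 * d := by
    have h1 := separation_le hC hn R ω hτ hN hg
    have hmp : 0 < m * p := mul_pos hm0 hp
    refine le_of_mul_le_mul_left (?_ : m * p * χ ≤ m * p * (2 * d)) hmp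
    nlinarith
  obtain ⟨σ, U, hest⟩ := exists_estError_eq C R (assemble c O)
  set C' := moveCluster σ C with hC'
  set R' := moveGroup U C R with hR'
  set ε := estError .orthogonal (assemble C R) (assemble c O) with hε
  have hAV : ∀ i k, block (A * assemble C' R') i (σ k)
      = block (A * assemble C R) i k * toMat (U k) := by
    intro i k
    rw [hC', hR', ← assemble_mul_symMat, ← Matrix.mul_assoc, block_mul_symMat]
  have hdiag : ∀ i, block (A * assemble C' R') i (C' i) = g i • toMat (R' i) := by
    intro i
    rw [hC', moveCluster, hAV, block_observation_own, smul_mul_assoc, hR', toMat_moveGroup]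
  have hsep' : ∀ i l, l ≠ C' i → ∀ U0 ∈ OGroup d,
      s ≤ d * g i - frobInner U0 (block (A * assemble C' R') i l) := by
    intro i l hl U0 hU0
    obtain ⟨k, rfl⟩ := σ.surjective l
    rw [hAV, frobInner_mul_right]
    refine hsepU i k (fun h => hl (by rw [h]; rfl)) _ ?_
    exact mul_mem_OGroup hU0 (transpose_mem_OGroup (toMat_mem _))
  have hεsq : frobInner (assemble C' R' - assemble c O) (assemble C' R' - assemble c O) = ε ^ 2 := by
    rw [hest, frobNorm_sub_comm, frobNorm_sq]
  -- The range up to `2 p` leaves room for the trivial group, where `max p q` takes the place of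
  -- `p`.
  have hbudget : ∀ P, P ≤ 2 * p → P * ε ^ 2 ≤ s / (2 * d) := by
    intro P hP
    have h1 : ε ^ 2 ≤ m * χ ^ 2 / (8 * d ^ 2) := by
      rw [le_div_iff₀ (by positivity)]; linarith
    calc P * ε ^ 2 ≤ 2 * p * (m * χ ^ 2 / (8 * d ^ 2)) := by
          refine mul_le_mul hP h1 (sq_nonneg _) (by positivity)
      _ = s * χ / (4 * d ^ 2) := by rw [hs]; field_simp; ring
      _ ≤ s * (2 * d) / (4 * d ^ 2) := by gcongr
      _ = s / (2 * d) := by field_simp; ring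
  have hQ1 : s / (2 * d) ≤ s / 2 := by
    rw [div_le_div_iff₀ (by positivity) (by norm_num)]
    nlinarith
  have hQ2 : ∀ i, s / (2 * d) ≤ g i / 2 := by
    intro i
    rw [div_le_div_iff₀ (by positivity) (by norm_num)]
    nlinarith [hg i]
  set M := meanObservation p q C R with hM
  have hmean : (∀ i l, l ≠ C' i → ∀ U ∈ OGroup d,
      -(s / (2 * d)) ≤ frobInner (toMat (R' i)) (block (M * (assemble c O - assemble C' R')) i (C' i))
        - frobInner U (block (M * (assemble c O - assemble C' R')) i l)) ∧
      (∀ i, ∀ U ∈ OGroup d, -(s / (2 * d) / 2) * frobInner (toMat (R' i) - U) (toMat (R' i) - U)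
      ≤ frobInner (toMat (R' i) - U) (block (M * (assemble c O - assemble C' R')) i (C' i))) := by
    by_cases hcase : d = 1 ∧ κ = .specialOrthogonal
    · obtain ⟨rfl, rfl⟩ := hcase
      have hqp : q ≤ 2 * p := by
        have h1 := cross_prob_le hK hC hm R ω hs0 hN hsepU
        nlinarith
      have hMabs : ∀ x y, |M x y| ≤ max p q := by
        intro x y
        rw [hM, meanObservation, of_apply]
        have h1 : ∀ a b : Fin 1, (1 : Matrix (Fin 1) (Fin 1) ℝ) a b = 1 := by
          intro a b
          rw [Subsingleton.elim a b, one_apply_eq]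
        split_ifs
        · rw [toMat_eq_one, toMat_eq_one, transpose_one, Matrix.one_mul, h1, mul_one, abs_of_pos hp]
          exact le_max_left _ _
        · rw [meanMat_eq_one, h1, mul_one, abs_of_nonneg hq]
          exact le_max_right _ _
      have hb := hbudget (max p q) (max_le (by linarith) hqp)
      rw [← hεsq] at hb
      exact ⟨fun i l hl U hU => frobInner_diff_rows_scalar C' c R' O M hMabs hb i l hl U hU,
        fun i U hU => frobInner_diff_rotation_scalar C' c R' O M hMabs hb i U hU⟩
    · have hMblock : ∀ i j, sqBlock M i j
          = if C' i = C' j then p • (toMat (R' i) * (toMat (R' j))ᵀ) else 0 := by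
        intro i j
        rw [hM, sqBlock_meanObservation, meanMat_eq_zero hcase, smul_zero]
        by_cases h : C i = C j
        · rw [if_pos h, if_pos (by rw [hC', moveCluster, moveCluster, h]), hR', toMat_moveGroup,
            toMat_moveGroup, ← h, transpose_mul, Matrix.mul_assoc, ← Matrix.mul_assoc (toMat (U _)),
            toMat_mul_transpose, Matrix.one_mul]
        · rw [if_neg h, if_neg (fun h' : C' i = C' j => h (σ.injective h'))]
      have hb := hbudget p (by linarith)
      rw [← hεsq] at hb
      exact ⟨fun i l hl U hU => frobInner_diff_rows C' c R' O hp.le M hMblock hb i l hl U hU,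
        fun i U0 hU0 => frobInner_diff_rotation hd C' c R' O hp.le M hMblock
          (fun k => crossCov_symm C R c O hest k) hb i U0 hU0⟩
  have hfinal := norm_sub_le_of_separation hd C' c c' R' O O' A M hτ hs0 hN g hg hdiag hsep'
    (frobInner_le_of_isProj (balanced_moveCluster hC σ) hW)
    (fun i l hl U hU => (neg_le_neg hQ1).trans (hmean.1 i l hl U hU))
    (fun i U hU => by
      refine le_trans ?_ (hmean.2 i U hU)
      refine mul_le_mul_of_nonneg_right ?_ (frobInner_self_nonneg _)
      linarith [hQ2 i])
  rw [← hest] at hfinal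
  refine (estError_le C R (assemble c' O') σ U).trans ?_
  rw [frobNorm_sub_comm]
  set F := frobNorm (assemble C' R' - assemble c' O')
  have hε0 : 0 ≤ ε := hest ▸ frobNorm_nonneg _
  have h1 : s * F ≤ 4 * d * (τ * ε) := by
    rw [div_mul_eq_mul_div, div_le_iff₀ (by positivity)] at hfinal
    linarith
  have h2 : 4 * d * (τ * ε) ≤ s * (1 / 2 * ε) := by nlinarith
  exact le_of_mul_le_mul_left (h1.trans h2) hs0

theorem estError_nonneg (V V' : Matrix (Fin n × Fin d) (Fin K × Fin d) ℝ) :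
    0 ≤ estError .orthogonal V' V :=
  Real.iInf_nonneg fun _ => frobNorm_nonneg _

/-- The error does not increase, so the smallness required at the start persists and the one-step
result applies at every time. -/
theorem estError_sequence {m : ℕ} (hK : 2 ≤ K) (hd : 1 ≤ d) (hn : 0 < n) (hm : 0 < m)
    {p q : ℝ} (hp : 0 < p) (hq : 0 ≤ q) {C : Fin n → Fin K} (hC : Balanced m C)
    (R : Fin n → groupOf d κ) (ω : Fin n × Fin n → Bool × groupOf d κ)
    {τ : ℝ} (hτ : 0 ≤ τ) (hN : BilinBound (observation C R ω - meanObservation p q C R) τ)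
    {χ : ℝ} (hχ : 0 < χ) (hτ1 : 2 * τ ≤ m * p) (hτ2 : 8 * d * τ ≤ χ * m * p)
    (hsep : PreservesBySeparation (observation C R ω) C (assemble C R) (χ * m * p))
    {V : ℕ → Matrix (Fin n × Fin d) (Fin K × Fin d) ℝ}
    (hV : IsGPMSequence m (observation C R ω) V)
    (hinit : 8 * d ^ 2 * estError .orthogonal (assemble C R) (V 0) ^ 2 ≤ m * χ ^ 2) (t : ℕ) :
    estError .orthogonal (assemble C R) (V (t + 1))
      ≤ 1 / 2 * estError .orthogonal (assemble C R) (V t) := by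
  have hmem : ∀ t, V t ∈ relaxed n K d m := by
    intro t
    cases t with
    | zero => exact hV.1
    | succ t => exact (hV.2 t).1
  have hstep : ∀ t, 8 * d ^ 2 * estError .orthogonal (assemble C R) (V t) ^ 2 ≤ m * χ ^ 2 →
      estError .orthogonal (assemble C R) (V (t + 1))
        ≤ 1 / 2 * estError .orthogonal (assemble C R) (V t) := fun t ht =>
    estError_step hK hd hn hm hp hq hC R ω hτ hN hχ hτ1 hτ2 hsep (hmem t) (hV.2 t) ht
  refine hstep t ?_
  induction t with
  | zero => exact hinit
  | succ t ih =>
    have h1 := hstep t ih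
    have h0 := estError_nonneg (V (t + 1)) (assemble C R)
    have h2 : estError .orthogonal (assemble C R) (V (t + 1)) ^ 2
        ≤ estError .orthogonal (assemble C R) (V t) ^ 2 :=
      pow_le_pow_left₀ h0 (by linarith [estError_nonneg (V t) (assemble C R)]) 2
    exact (mul_le_mul_of_nonneg_left h2 (by positivity)).trans ih

/-- The initial accuracy, in terms of the separation alone. -/
theorem init_sq_le {m : ℕ} {d χ x ρ ε : ℝ} (hχ : 0 < χ) (hx : 0 ≤ x) (hε : 0 ≤ ε)
    (hρ : 2 * √2 * √(d ^ 2 / χ ^ 2 + x) < ρ) (h : ε ≤ √m / ρ) :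
    8 * d ^ 2 * ε ^ 2 ≤ m * χ ^ 2 := by
  have h0 : 0 ≤ 2 * √2 * √(d ^ 2 / χ ^ 2 + x) := by positivity
  have hρ0 : 0 < ρ := h0.trans_lt hρ
  have h1 := pow_le_pow_left₀ h0 hρ.le 2
  rw [mul_pow, mul_pow, Real.sq_sqrt (by norm_num), Real.sq_sqrt (by positivity)] at h1
  have h2 := pow_le_pow_left₀ hε h 2
  rw [div_pow, Real.sq_sqrt (Nat.cast_nonneg m), le_div_iff₀ (by positivity)] at h2
  have h3 : 8 * (d ^ 2 / χ ^ 2) ≤ ρ ^ 2 := by linarith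
  rw [← mul_div_assoc, div_le_iff₀ (by positivity)] at h3
  have h4 : 8 * d ^ 2 * ε ^ 2 ≤ ρ ^ 2 * χ ^ 2 * ε ^ 2 :=
    mul_le_mul_of_nonneg_right h3 (sq_nonneg ε)
  have h5 := mul_le_mul_of_nonneg_right h2 (sq_nonneg χ)
  linarith

theorem measure_noise_le {d : ℕ} (B η : ℝ) (hη : 0 < η) :
    ∃ N : ℕ, ∀ n : ℕ, N ≤ n → 0 < Real.log n ∧
      ∀ (K : ℕ) (κ : GroupKind) (p q : ℝ), p ∈ Set.Icc (0 : ℝ) 1 → q ∈ Set.Icc (0 : ℝ) 1 →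
        max p q * n ≤ B * Real.log n → ∀ (C : Fin n → Fin K) (R : Fin n → groupOf d κ),
        sgbmMeasure d κ p q C {ω | ¬ ∀ a b, BilinBound (noiseMatrix (edgeNoise p q C R a b) ω)
          (η * Real.log n)} ≤ ENNReal.ofReal ((n : ℝ) ^ (-1 : ℝ)) := by
  obtain ⟨N, hN⟩ := exists_noise_bound B η hη
  -- With `d ^ 2 ≤ n`, the union bound over the `d ^ 2` entry positions costs only one power of `n`.
  refine ⟨max N (d ^ 2), fun n hn => ?_⟩
  obtain ⟨hl, hb⟩ := hN n ((le_max_left _ _).trans hn)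
  refine ⟨hl, fun K κ p q hp hq hpq C R => ?_⟩
  have hnd : (d : ℝ) ^ 2 ≤ n := by exact_mod_cast (le_max_right _ _).trans hn
  have hn0 : (0 : ℝ) < n := by
    rcases Nat.eq_zero_or_pos n with h | h
    · rw [h] at hl; simp at hl
    · exact_mod_cast h
  have : IsProbabilityMeasure (sgbmMeasure d κ p q C) := by
    unfold sgbmMeasure; infer_instance
  have h0 : 0 ≤ max p q := hp.1.trans (le_max_left _ _)
  have hsub : {ω | ¬ ∀ a b, BilinBound (noiseMatrix (edgeNoise p q C R a b) ω) (η * Real.log n)}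
      ⊆ ⋃ x : Fin d × Fin d,
        {ω | ¬ BilinBound (noiseMatrix (edgeNoise p q C R x.1 x.2) ω) (η * Real.log n)} := by
    intro ω hω
    have hω' : ¬ ∀ a b, BilinBound (noiseMatrix (edgeNoise p q C R a b) ω) (η * Real.log n) := hω
    push Not at hω'
    obtain ⟨a, b, hab⟩ := hω'
    exact Set.mem_iUnion.2 ⟨(a, b), hab⟩
  calc _ ≤ ∑ x : Fin d × Fin d, sgbmMeasure d κ p q C
        {ω | ¬ BilinBound (noiseMatrix (edgeNoise p q C R x.1 x.2) ω) (η * Real.log n)} :=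
        (measure_mono hsub).trans (measure_iUnion_fintype_le _ _)
    _ ≤ ∑ _x : Fin d × Fin d, ENNReal.ofReal ((n : ℝ) ^ (-2 : ℝ)) :=
        Finset.sum_le_sum fun x _ =>
          hb _ _ _ (noiseFamily_edgeNoise hp hq C R x.1 x.2) h0 hpq
    _ = ENNReal.ofReal (d ^ 2 * (n : ℝ) ^ (-2 : ℝ)) := by
        rw [ENNReal.ofReal_mul (by positivity), Finset.sum_const, nsmul_eq_mul]
        congr 1
        rw [Finset.card_univ, Fintype.card_prod, Fintype.card_fin, ← sq,
          ENNReal.ofReal_pow (Nat.cast_nonneg d), ENNReal.ofReal_natCast]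
        push_cast; rfl
    _ ≤ _ := by
        refine ENNReal.ofReal_le_ofReal ?_
        calc (d : ℝ) ^ 2 * (n : ℝ) ^ (-2 : ℝ) ≤ n * (n : ℝ) ^ (-2 : ℝ) := by gcongr
          _ = (n : ℝ) ^ (-1 : ℝ) := by
            nth_rewrite 1 [← Real.rpow_one (n : ℝ)]
            rw [← Real.rpow_add hn0]; norm_num

end Step
end GPM

/-! ### Choice of constants and conclusion -/

theorem theorem4 (κ : GPM.GroupKind) (K d : ℕ) (hK : 2 ≤ K) (hd : 1 ≤ d)
    (a b : ℝ) (ha : 0 < a) (hab : a ≤ b) :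
    ∃ c : ℝ, 0 < c ∧ ∀ χ₀ : ℝ, 0 < χ₀ → ∃ N : ℕ,
      ∀ (n m : ℕ), n = K * m → N ≤ n →
      ∀ (α β : ℝ), α ∈ Set.Icc a b → β ∈ Set.Icc a b →
      ∀ (p q : ℝ), p = α * Real.log n / n → q = β * Real.log n / n →
      ∀ (C : Fin n → Fin K) (R : Fin n → GPM.groupOf d κ), GPM.Balanced m C →
      GPM.sgbmMeasure d κ p q C
        {ω | ¬ ∀ (χ : ℝ) (V : ℕ → Matrix (Fin n × Fin d) (Fin K × Fin d) ℝ),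
          χ₀ ≤ χ →
          GPM.IsGPMSequence m (GPM.observation C R ω) V →
          GPM.PreservesBySeparation (GPM.observation C R ω) C (GPM.assemble C R) (χ * m * p) →
          (∀ i, Real.sqrt (2 * K * β) / α * m * p
            ≤ GPM.blockNuclear (GPM.observation C R ω * GPM.assemble C R) i (C i)) →
          (∃ ρ : ℝ, 2 * Real.sqrt 2 * Real.sqrt (d ^ 2 / χ ^ 2 + α ^ 2 / (2 * K * β)) < ρ ∧
            GPM.estError GPM.GroupKind.orthogonal (GPM.assemble C R) (V 0)
              ≤ Real.sqrt m / ρ) →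
          ∀ t : ℕ, GPM.estError GPM.GroupKind.orthogonal (GPM.assemble C R) (V (t + 1))
            ≤ 1 / 2 * GPM.estError GPM.GroupKind.orthogonal (GPM.assemble C R) (V t)}
      ≤ ENNReal.ofReal ((n : ℝ) ^ (-c)) := by
  
  refine ⟨1, one_pos, fun χ₀ hχ₀ => ?_⟩
  have hK0 : (0 : ℝ) < K := by exact_mod_cast (by omega : 0 < K)
  have hd0 : (0 : ℝ) < d := by exact_mod_cast hd
  -- Since `m p ≥ a log n / K`, a noise level `τ ≤ r log n` satisfies both `2τ ≤ m p` and `8 d τ ≤ χ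
  -- m p` for all `χ ≥ χ₀`.
  set r : ℝ := min (χ₀ / (8 * d)) (1 / 2) * a / K with hr
  have hr0 : 0 < r := by
    have : 0 < min (χ₀ / (8 * d)) (1 / 2) := lt_min (by positivity) (by norm_num)
    positivity
  -- The factor `2 d ^ 2` of `bilinBound_observation` turns this level into half of `r log n`; the
  -- other half absorbs the diagonal term 1 once `log n ≥ 2 / r`.
  obtain ⟨N₁, hN₁⟩ := GPM.measure_noise_le (d := d) b (r / (4 * d ^ 2)) (by positivity)
  have hev : ∀ᶠ n : ℕ in Filter.atTop, 2 / r ≤ Real.log n ∧ b * Real.log n ≤ n := by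
    have h1 : Filter.Tendsto (fun n : ℕ => Real.log n) Filter.atTop Filter.atTop :=
      Real.tendsto_log_atTop.comp tendsto_natCast_atTop_atTop
    have h2 := (Real.isLittleO_log_id_atTop.const_mul_left b).bound (c := 1) one_pos
    have h3 := (tendsto_natCast_atTop_atTop (R := ℝ)).eventually h2
    filter_upwards [h1.eventually_ge_atTop (2 / r), h3] with n hn1 hn2
    refine ⟨hn1, (le_abs_self _).trans ?_⟩
    simpa using hn2
  obtain ⟨N₂, hN₂⟩ := Filter.eventually_atTop.1 hev
  refine ⟨max (max N₁ N₂) 1, fun n m hnm hn α β hα hβ p q hp hq C R hC => ?_⟩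
  obtain ⟨hl, hmeas⟩ := hN₁ n ((le_max_left _ _).trans ((le_max_left _ _).trans hn))
  obtain ⟨hlr, hbn⟩ := hN₂ n ((le_max_right _ _).trans ((le_max_left _ _).trans hn))
  have hnpos : 0 < n := (le_max_right _ _).trans hn
  have hn0 : (0 : ℝ) < n := by exact_mod_cast hnpos
  have hm : 0 < m := Nat.pos_of_ne_zero fun h => by simp [hnm, h] at hnpos
  have hprob : ∀ γ ∈ Set.Icc a b, ∀ x, x = γ * Real.log n / n →
      0 < x ∧ x ≤ 1 ∧ x * n ≤ b * Real.log n := by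
    rintro γ ⟨h1, h2⟩ x rfl
    have h3 : γ * Real.log n ≤ b * Real.log n := mul_le_mul_of_nonneg_right h2 hl.le
    have h4 : 0 < γ := ha.trans_le h1
    refine ⟨by positivity, ?_, ?_⟩
    · rw [div_le_one hn0]; linarith
    · rw [div_mul_cancel₀ _ hn0.ne']; exact h3
  obtain ⟨hp0, hp1, hpn⟩ := hprob α hα p hp
  obtain ⟨hq0, hq1, hqn⟩ := hprob β hβ q hq
  have hpq : max p q * n ≤ b * Real.log n := by
    rw [max_mul_of_nonneg _ _ hn0.le]
    exact max_le hpn hqn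
  refine (MeasureTheory.measure_mono ?_).trans
    (hmeas K κ p q ⟨hp0.le, hp1⟩ ⟨hq0.le, hq1⟩ hpq C R)
  refine fun ω hω hgood => hω ?_
  intro χ V hχ hV hsep _ hinit t
  obtain ⟨ρ, hρ, hinit⟩ := hinit
  have hχ0 : 0 < χ := hχ₀.trans_le hχ
  have hN := GPM.bilinBound_observation ⟨hp0.le, hp1⟩ ⟨hq0.le, hq1⟩ C R ω
    (by positivity : 0 ≤ r / (4 * d ^ 2) * Real.log n) hgood
  set τ := 1 + 2 * (d : ℝ) ^ 2 * (r / (4 * d ^ 2) * Real.log n) with hτ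
  have hτ0 : 0 ≤ τ := by positivity
  have hτr : τ ≤ r * Real.log n := by
    have h1 : τ = 1 + r * Real.log n / 2 := by rw [hτ]; field_simp; ring
    rw [div_le_iff₀ hr0] at hlr
    rw [h1]; linarith
  have hmp : a * Real.log n / K ≤ m * p := by
    have h1 : (m : ℝ) * p = α * Real.log n / K := by
      have hm0 : (0 : ℝ) < m := by exact_mod_cast hm
      rw [hp, hnm]
      push_cast
      field_simp
    rw [h1]
    have := hα.1
    gcongr
  have hτmp : τ ≤ min (χ₀ / (8 * d)) (1 / 2) * (m * p) := by
    refine hτr.trans ?_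
    have h2 : r * Real.log n = min (χ₀ / (8 * d)) (1 / 2) * (a * Real.log n / K) := by
      rw [hr]; ring
    rw [h2]
    exact mul_le_mul_of_nonneg_left hmp (le_min (by positivity) (by norm_num))
  have hmp0 : 0 ≤ m * p := by positivity
  have hτ1 : 2 * τ ≤ m * p := by
    have := mul_le_mul_of_nonneg_right (min_le_right (χ₀ / (8 * d)) (1 / 2)) hmp0
    linarith
  have hτ2 : 8 * d * τ ≤ χ * m * p := by
    have h1 := mul_le_mul_of_nonneg_right (min_le_left (χ₀ / (8 * d)) (1 / 2)) hmp0
    have h2 : 8 * d * τ ≤ 8 * d * (χ₀ / (8 * d) * (m * p)) :=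
      mul_le_mul_of_nonneg_left (hτmp.trans h1) (by positivity)
    have h3 : 8 * d * (χ₀ / (8 * d) * (m * p)) = χ₀ * (m * p) := by field_simp
    have h4 := mul_le_mul_of_nonneg_right hχ hmp0
    linarith
  have hβ0 : 0 < β := ha.trans_le hβ.1
  exact GPM.estError_sequence hK hd hnpos hm hp0 hq0.le hC R ω hτ0 hN hχ0 hτ1 hτ2 hsep hV
    (GPM.init_sq_le hχ0 (by positivity) (GPM.estError_nonneg _ _) hρ hinit) t
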